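/- Let $d\ge 1$ and let $\mathbb B_d$ be the open Euclidean unit ball of $\mathbb C^d$. A unitarily invariant kernel on $\mathbb B_d$ is a nowhere vanishing function $k(z,w)=\sum_{n\ge 0}a_n^{(k)}\langle z,w\rangle^n$ on $\mathbb B_d\times\mathbb B_d$, where the series converges, with $a_n^{(k)}>0$ for all $n$ and $a_0^{(k)}=1$. Put $\sum_{n\ge1}b_n^{(k)}t^n=1-1/\sum_{n\ge0}a_n^{(k)}t^n$ and, for a multi-index $\alpha\in\mathbb Z_+^d$, $a_\alpha^{(k)}=a_{|\alpha|}^{(k)}\frac{|\alpha|!}{\alpha!}$ and, for $\alpha\ne0$, $b_\alpha^{(k)}=b_{|\alpha|}^{(k)}\frac{|\alpha|!}{\alpha!}$. Let $H_k$ be the reproducing kernel Hilbert space of $k$, and for a Hilbert space $\mathcal F$ identify $H_k\otimes\mathcal F$ with the space of functions $f(z)=\sum_\alpha c_\alpha z^\alpha$ on $\mathbb B_d$, $c_\alpha\in\mathcal F$, with $\|f\|^2=\sum_\alpha\|c_\alpha\|^2/a_\alpha^{(k)}<\infty$. A commuting tuple $T=(T_1,\dots,T_d)$ of bounded operators on a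 Hilbert space $\mathcal H$ is a $1/k$-contraction if $\sum_{\alpha\ne0}b_\alpha^{(k)}T^\alpha(T^\alpha)^*$ converges in the strong operator topology (summed by increasing degree $|\alpha|$) to a contraction; then $\Delta_T=\bigl(I-\sum_{\alpha\ne0}b_\alpha^{(k)}T^\alpha(T^\alpha)^*\bigr)^{1/2}$. It is pure if $\sum_\alpha a_\alpha^{(k)}T^\alpha\Delta_T^2(T^\alpha)^*=I$ strongly; then $V_T:\mathcal H\to H_k\otimes\overline{\mathrm{Ran}}\,\Delta_T$, $V_Th=\sum_\alpha a_\alpha^{(k)}z^\alpha\otimes\Delta_T(T^\alpha)^*h$, is an isometry. A unitarily invariant kernel $s$ is a complete Nevanlinna-Pick (CNP) kernel if (i) it is irreducible: $s$ is nowhere zero, and $s(\cdot,w)$ and $s(\cdot,v)$ are linearly independent for $v\neq w$; and (ii) for all positive integers $m,n$, all points $\lambda_1,\dots,\lambda_N\in\mathbb B_d$ and all $m\times n$ matrices $W_1,\dots,W_N$ such that the block matrix $[(I-W_iW_j^*)s(\lambda_i,\lambda_j)]_{i,j}$ is positive semi-definite, there is a function $\varphi$ on $\mathbb B_d$ with $m\times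 n$ matrix values and $\varphi(\lambda_i)=W_i$ for all $i$, such that multiplication by $\varphi$ is a contraction from $H_s\otimes\mathbb C^n$ to $H_s\otimes\mathbb C^m$. **Theorem.** Let $k$ and $s$ be unitarily invariant kernels on $\mathbb B_d$ such that $s$ is a CNP kernel and $k=s\cdot g$ for a positive semi-definite kernel $g$ on $\mathbb B_d$. Then every pure $1/k$-contraction $T$ admits a characteristic function through $s$: there are a Hilbert space $\mathcal E$ and an analytic function $\theta:\mathbb B_d\to\mathcal B(\mathcal E,\overline{\mathrm{Ran}}\,\Delta_T)$ such that multiplication by $\theta$ is a bounded operator $M_\theta:H_s\otimes\mathcal E\to H_k\otimes\overline{\mathrm{Ran}}\,\Delta_T$ and $$I-V_TV_T^*=M_\theta M_\theta^*.$$ -/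

import Mathlib

open scoped ComplexOrder

noncomputable section

namespace CharFn

universe u v

/-- The open Euclidean unit ball of `ℂ^d`. -/
abbrev Ball (d : ℕ) : Set (EuclideanSpace ℂ (Fin d)) := Metric.ball 0 1

/-- The monomial `z^α = z₁^{α₁} ⋯ z_d^{α_d}`. -/
def monomial {d : ℕ} (z : EuclideanSpace ℂ (Fin d)) (α : Fin d → ℕ) : ℂ := ∏ i, z i ^ α i

/-- The multinomial coefficient `|α|! / (α₁! ⋯ α_d!)`. -/
abbrev multinom {d : ℕ} (α : Fin d → ℕ) : ℕ := Nat.multinomial Finset.univ α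

/-- The multi-indices `α` with `|α| = n`. -/
abbrev multiIdx (d n : ℕ) : Finset (Fin d → ℕ) := Finset.piAntidiag Finset.univ n

/-- A (non-vanishing) unitarily invariant kernel `k(z, w) = ∑ₙ aₙ ⟨z, w⟩ⁿ` on the unit ball, given
by its coefficients `aₙ > 0`, `a₀ = 1`. Here `⟨z, w⟩ = ∑ zᵢ conj(wᵢ)` is Mathlib's `inner ℂ w z`. -/
structure UIKernel (d : ℕ) where
  coeff : ℕ → ℝ
  coeff_pos : ∀ n, 0 < coeff n
  coeff_zero : coeff 0 = 1
  summable : ∀ z w : Ball d, Summable fun n => (coeff n : ℂ) * inner ℂ w.1 z.1 ^ n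
  ne_zero : ∀ z w : Ball d, ∑' n, (coeff n : ℂ) * inner ℂ w.1 z.1 ^ n ≠ 0

namespace UIKernel

variable {d : ℕ}

/-- The kernel function `k(z, w)`. -/
def fn (k : UIKernel d) (z w : Ball d) : ℂ := ∑' n, (k.coeff n : ℂ) * inner ℂ w.1 z.1 ^ n

/-- The numbers `bₙ` with `∑_{n ≥ 1} bₙ tⁿ = 1 - 1 / ∑ₙ aₙ tⁿ` (and `b₀ = 0`). -/
def b (k : UIKernel d) (n : ℕ) : ℝ := PowerSeries.coeff n (1 - (PowerSeries.mk k.coeff)⁻¹)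

/-- `a_α = a_{|α|} |α|! / α!`. -/
def aMulti (k : UIKernel d) (α : Fin d → ℕ) : ℝ := k.coeff (∑ i, α i) * multinom α

/-- `b_α = b_{|α|} |α|! / α!`; note `b_0 = 0`. -/
def bMulti (k : UIKernel d) (α : Fin d → ℕ) : ℝ := k.b (∑ i, α i) * multinom α

lemma b_zero (k : UIKernel d) : k.b 0 = 0 := by
  simp [b, k.coeff_zero]

lemma aMulti_pos (k : UIKernel d) (α : Fin d → ℕ) : 0 < k.aMulti α :=
  mul_pos (k.coeff_pos _) (by exact_mod_cast Nat.multinomial_pos _ _)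

end UIKernel

/-! ### The Hilbert space `H_k ⊗ E` -/

section Space

variable {d : ℕ}

/-- The Hilbert space `H_k ⊗ E = H_k(E)` of the `E`-valued functions `f(z) = ∑_α c_α z^α` on the
ball with `‖f‖² = ∑_α ‖c_α‖² ‖z^α‖² < ∞`, where `‖z^α‖² = 1 / a_α`. An element is stored through
the square summable family `c_α / √a_α` of its coefficients with respect to the orthonormal basis
`√a_α z^α` of `H_k`; its values are given by the instance of `RKHS` below. -/
def HSpace (_k : UIKernel d) (E : Type v) [NormedAddCommGroup E] : Type v :=
  lp (fun _ : Fin d → ℕ => E) 2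

variable (k : UIKernel d) (E : Type v) [NormedAddCommGroup E]

instance : NormedAddCommGroup (HSpace k E) :=
  inferInstanceAs (NormedAddCommGroup (lp (fun _ : Fin d → ℕ => E) 2))

variable [InnerProductSpace ℂ E]

instance : InnerProductSpace ℂ (HSpace k E) :=
  inferInstanceAs (InnerProductSpace ℂ (lp (fun _ : Fin d → ℕ => E) 2))

instance [CompleteSpace E] : CompleteSpace (HSpace k E) :=
  inferInstanceAs (CompleteSpace (lp (fun _ : Fin d → ℕ => E) 2))

variable {E}

/-- The coefficient `c_α / √a_α` of an element of `H_k ⊗ E`. -/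
def HSpace.coord {k : UIKernel d} (f : HSpace k E) (α : Fin d → ℕ) : E :=
  (show lp (fun _ : Fin d → ℕ => E) 2 from f) α

/-- The value at `z` of the function `√a_α z^α`. -/
def UIKernel.basisFn (z : EuclideanSpace ℂ (Fin d)) (α : Fin d → ℕ) : ℂ :=
  (Real.sqrt (k.aMulti α) : ℂ) * monomial z α

lemma hasSum_fiber {F : Type*} [NormedAddCommGroup F] (f : (Fin d → ℕ) → F) (n : ℕ) :
    HasSum (fun x : {α : Fin d → ℕ // ∑ i, α i = n} => f x) (∑ α ∈ multiIdx d n, f α) := by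
  have h : {α : Fin d → ℕ | ∑ i, α i = n} = ↑(multiIdx d n) := by
    ext α; simp [multiIdx]
  have := (multiIdx d n).hasSum f
  change HasSum (fun x : ↥{α : Fin d → ℕ | ∑ i, α i = n} => f x) _
  rw [h]
  exact this

lemma hasSum_multiIdx {F : Type*} [NormedAddCommGroup F] {f : (Fin d → ℕ) → F} {s : F}
    (hf : HasSum f s) : HasSum (fun n => ∑ α ∈ multiIdx d n, f α) s :=
  HasSum.sigma ((Equiv.sigmaFiberEquiv fun α : Fin d → ℕ => ∑ i, α i).hasSum_iff.2 hf)
    (fun n => hasSum_fiber f n)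

lemma summable_of_multiIdx {f : (Fin d → ℕ) → ℝ} (h0 : ∀ α, 0 ≤ f α)
    (hf : Summable fun n => ∑ α ∈ multiIdx d n, f α) : Summable f := by
  rw [← (Equiv.sigmaFiberEquiv fun α : Fin d → ℕ => ∑ i, α i).summable_iff]
  refine (summable_sigma_of_nonneg fun _ => h0 _).2 ⟨fun n => (hasSum_fiber f n).summable, ?_⟩
  refine hf.congr fun n => ?_
  exact (hasSum_fiber f n).tsum_eq.symm

lemma inner_pow_eq (z w : EuclideanSpace ℂ (Fin d)) (n : ℕ) :
    inner ℂ w z ^ n =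
      ∑ α ∈ multiIdx d n, (multinom α : ℂ) * (monomial z α * star (monomial w α)) := by
  rw [PiLp.inner_apply, Finset.sum_pow_eq_sum_piAntidiag]
  refine Finset.sum_congr rfl fun α _ => ?_
  simp [monomial, mul_pow, Finset.prod_mul_distrib]

lemma UIKernel.coeff_mul_inner_pow (z w : EuclideanSpace ℂ (Fin d)) (n : ℕ) :
    (k.coeff n : ℂ) * inner ℂ w z ^ n =
      ∑ α ∈ multiIdx d n, k.basisFn z α * star (k.basisFn w α) := by
  rw [inner_pow_eq, Finset.mul_sum]
  refine Finset.sum_congr rfl fun α hα => ?_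
  have hn : ∑ i, α i = n := by simpa [multiIdx] using hα
  have hs : (Real.sqrt (k.aMulti α) : ℂ) * (Real.sqrt (k.aMulti α) : ℂ) =
      (k.coeff n : ℂ) * (multinom α : ℂ) := by
    rw [← Complex.ofReal_mul, Real.mul_self_sqrt (k.aMulti_pos α).le, UIKernel.aMulti, hn]
    push_cast; rfl
  simp only [UIKernel.basisFn, star_mul', Complex.star_def, Complex.conj_ofReal]
  linear_combination (-monomial z α * (starRingEnd ℂ) (monomial w α)) * hs

lemma UIKernel.summable_basisFn_sq (z : Ball d) : Summable fun α => ‖k.basisFn z.1 α‖ ^ 2 := by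
  refine summable_of_multiIdx (fun _ => by positivity) ?_
  refine (k.summable z z).norm.congr fun n => ?_
  rw [k.coeff_mul_inner_pow]
  have : ∀ c : ℂ, c * star c = ((‖c‖ ^ 2 : ℝ) : ℂ) := fun c => by
    rw [Complex.star_def, Complex.mul_conj']; push_cast; rfl
  simp only [this, ← Complex.ofReal_sum, Complex.norm_real, Real.norm_eq_abs]
  exact abs_of_nonneg (Finset.sum_nonneg fun _ _ => by positivity)

lemma summable_norm_mul {f g : (Fin d → ℕ) → ℝ} (hf : Summable fun α => f α ^ 2)
    (hg : Summable fun α => g α ^ 2) (hf0 : ∀ α, 0 ≤ f α) (hg0 : ∀ α, 0 ≤ g α) :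
    Summable fun α => f α * g α := by
  refine Summable.of_nonneg_of_le (fun α => mul_nonneg (hf0 α) (hg0 α)) (fun α => ?_) (hf.add hg)
  nlinarith [sq_nonneg (f α - g α), mul_nonneg (hf0 α) (hg0 α)]

lemma UIKernel.hasSum_basisFn (z w : Ball d) :
    HasSum (fun α => k.basisFn z.1 α * star (k.basisFn w.1 α)) (k.fn z w) := by
  have hs : Summable fun α => k.basisFn z.1 α * star (k.basisFn w.1 α) := by
    refine Summable.of_norm ?_
    simp only [norm_mul, norm_star]
    exact summable_norm_mul (k.summable_basisFn_sq z) (k.summable_basisFn_sq w)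
      (fun _ => norm_nonneg _) (fun _ => norm_nonneg _)
  have h := hasSum_multiIdx hs.hasSum
  simp only [← k.coeff_mul_inner_pow] at h
  have h2 : k.fn z w = _ := h.tsum_eq
  rw [h2]
  exact hs.hasSum

variable {k}

set_option linter.unusedSectionVars false in
lemma HSpace.norm_sq (f : HSpace k E) : HasSum (fun α => ‖f.coord α‖ ^ 2) (‖f‖ ^ 2) := by
  have h := lp.hasSum_norm (p := 2) (by norm_num) (show lp (fun _ : Fin d → ℕ => E) 2 from f)
  simp only [ENNReal.toReal_ofNat, Real.rpow_ofNat] at h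
  exact h

lemma HSpace.summable_norm_eval (f : HSpace k E) (z : Ball d) :
    Summable fun α => ‖k.basisFn z.1 α • f.coord α‖ := by
  simp only [norm_smul]
  exact summable_norm_mul (k.summable_basisFn_sq z) f.norm_sq.summable
    (fun _ => norm_nonneg _) (fun _ => norm_nonneg _)

variable [CompleteSpace E]

lemma HSpace.summable_eval (f : HSpace k E) (z : Ball d) :
    Summable fun α => k.basisFn z.1 α • f.coord α := (f.summable_norm_eval z).of_norm

/-- The value `f(z) = ∑_α c_α z^α` of `f ∈ H_k ⊗ E`, as a bounded linear map in `f`. -/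
def HSpace.evalCLM (k : UIKernel d) (E : Type v) [NormedAddCommGroup E] [InnerProductSpace ℂ E]
    [CompleteSpace E] (z : Ball d) : HSpace k E →L[ℂ] E :=
  LinearMap.mkContinuous
    { toFun := fun f => ∑' α, k.basisFn z.1 α • f.coord α
      map_add' := fun f g => by
        rw [← (f.summable_eval z).tsum_add (g.summable_eval z)]
        exact tsum_congr fun α => smul_add _ (f.coord α) (g.coord α)
      map_smul' := fun c f => by
        rw [RingHom.id_apply, ← (f.summable_eval z).tsum_const_smul]
        exact tsum_congr fun α => smul_comm _ c (f.coord α) }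
    (Real.sqrt (∑' α, ‖k.basisFn z.1 α‖ ^ 2)) (fun f => by
      refine (norm_tsum_le_tsum_norm (f.summable_norm_eval z)).trans ?_
      refine Real.tsum_le_of_sum_le (fun _ => norm_nonneg _) fun s => ?_
      refine abs_le_of_sq_le_sq' ?_ (by positivity) |>.2
      rw [mul_pow, Real.sq_sqrt (tsum_nonneg fun _ => by positivity)]
      simp only [norm_smul]
      refine (Finset.sum_mul_sq_le_sq_mul_sq _ _ _).trans ?_
      refine mul_le_mul ?_ ?_ (by positivity) (tsum_nonneg fun _ => by positivity)
      · exact (k.summable_basisFn_sq z).sum_le_tsum s fun _ _ => by positivity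
      · rw [← f.norm_sq.tsum_eq]
        exact f.norm_sq.summable.sum_le_tsum s fun _ _ => by positivity)

lemma HSpace.evalCLM_apply (f : HSpace k E) (z : Ball d) :
    HSpace.evalCLM k E z f = ∑' α, k.basisFn z.1 α • f.coord α := rfl

lemma powerSeries_unique {P : ℕ → ℂ} (h : ∀ t : ℂ, ‖t‖ < 1 → HasSum (fun n => t ^ n * P n) 0)
    (n : ℕ) : P n = 0 := by
  let p : FormalMultilinearSeries ℂ ℂ ℂ := fun n => ContinuousMultilinearMap.mkPiRing ℂ (Fin n) (P n)
  have hc : ∀ n, p.coeff n = P n := fun n => by simp [FormalMultilinearSeries.coeff, p]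
  have hp : HasFPowerSeriesAt (fun _ : ℂ => (0 : ℂ)) p 0 := by
    refine hasFPowerSeriesAt_iff.2 ?_
    filter_upwards [Metric.ball_mem_nhds (0 : ℂ) one_pos] with t ht
    simpa [hc] using h t (by simpa using ht)
  have h0 : p = 0 := HasFPowerSeriesAt.eq_zero hp
  rw [← hc, h0]
  simp [FormalMultilinearSeries.coeff]

lemma monomial_smul (t : ℂ) (z : EuclideanSpace ℂ (Fin d)) (α : Fin d → ℕ) :
    monomial (t • z) α = t ^ (∑ i, α i) * monomial z α := by
  simp [monomial, mul_pow, Finset.prod_mul_distrib, Finset.prod_pow_eq_pow_sum]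

lemma poly_unique {n : ℕ} {c : (Fin d → ℕ) → ℂ}
    (h : ∀ z : EuclideanSpace ℂ (Fin d), ∑ α ∈ multiIdx d n, c α * monomial z α = 0)
    {α : Fin d → ℕ} (hα : α ∈ multiIdx d n) : c α = 0 := by
  set Q : MvPolynomial (Fin d) ℂ := ∑ β ∈ multiIdx d n,
    MvPolynomial.monomial (Finsupp.equivFunOnFinite.symm β) (c β) with hQ
  have hQ0 : Q = 0 := by
    refine MvPolynomial.funext fun z => ?_
    rw [map_zero, ← h (WithLp.toLp 2 z), hQ, map_sum]
    refine Finset.sum_congr rfl fun β _ => ?_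
    rw [MvPolynomial.eval_monomial, Finsupp.prod_fintype _ _ (by simp)]
    rfl
  have h2 := congrArg (MvPolynomial.coeff (Finsupp.equivFunOnFinite.symm α)) hQ0
  rw [hQ, MvPolynomial.coeff_sum, Finset.sum_eq_single α] at h2
  · simpa using h2
  · intro β _ hβ
    rw [MvPolynomial.coeff_monomial, if_neg]
    exact fun hh => hβ (Finsupp.equivFunOnFinite.symm.injective hh)
  · exact fun hh => absurd hα hh

lemma HSpace.eq_zero_of_eval (f : HSpace k E) (hf : ∀ z, HSpace.evalCLM k E z f = 0) :
    f = 0 := by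
  have key : ∀ v : E, ∀ n : ℕ, ∀ z : EuclideanSpace ℂ (Fin d),
      ∑ α ∈ multiIdx d n, ((Real.sqrt (k.aMulti α) : ℂ) * inner ℂ v (f.coord α)) * monomial z α
        = 0 := by
    intro v n
    have hball : ∀ z : Ball d, ∑ α ∈ multiIdx d n,
        ((Real.sqrt (k.aMulti α) : ℂ) * inner ℂ v (f.coord α)) * monomial z.1 α = 0 := by
      intro z
      refine powerSeries_unique (P := fun n => ∑ α ∈ multiIdx d n,
        ((Real.sqrt (k.aMulti α) : ℂ) * inner ℂ v (f.coord α)) * monomial z.1 α) ?_ n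
      intro t ht
      have htz : t • z.1 ∈ Ball d := by
        have hz := z.2
        simp only [Ball, Metric.mem_ball, dist_zero_right, norm_smul] at hz ⊢
        nlinarith [norm_nonneg t, norm_nonneg z.1]
      have h1 := (f.summable_eval ⟨t • z.1, htz⟩).hasSum
      rw [← HSpace.evalCLM_apply, hf] at h1
      have h2 := hasSum_multiIdx ((innerSL ℂ v).hasSum h1)
      rw [map_zero] at h2
      refine h2.congr_fun fun m => ?_
      rw [Finset.mul_sum]
      refine Finset.sum_congr rfl fun α hα => ?_
      have hm : ∑ i, α i = m := by simpa [multiIdx] using hα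
      simp only [UIKernel.basisFn, monomial_smul, hm, innerSL_apply_apply, inner_smul_right]
      ring
    intro z
    have hpos : 0 < ‖z‖ + 1 := by positivity
    set r : ℂ := ((‖z‖ + 1 : ℝ) : ℂ) with hr
    have hr0 : r ≠ 0 := by rw [hr]; exact_mod_cast hpos.ne'
    have hz : r⁻¹ • z ∈ Ball d := by
      simp only [Ball, Metric.mem_ball, dist_zero_right, norm_smul, norm_inv, hr,
        Complex.norm_real, Real.norm_eq_abs, abs_of_pos hpos]
      rw [inv_mul_lt_iff₀ hpos]; linarith
    have h1 := hball ⟨r⁻¹ • z, hz⟩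
    have h2 : r ^ n * ∑ α ∈ multiIdx d n, ((Real.sqrt (k.aMulti α) : ℂ) *
        inner ℂ v (f.coord α)) * monomial (r⁻¹ • z) α = 0 := by rw [h1, mul_zero]
    rw [← h2, Finset.mul_sum]
    refine Finset.sum_congr rfl fun α hα => ?_
    have hm : ∑ i, α i = n := by simpa [multiIdx] using hα
    rw [monomial_smul, hm, inv_pow]
    field_simp
  have hc : ∀ α, f.coord α = 0 := by
    intro α
    refine ext_inner_left ℂ fun v => ?_
    have h1 := poly_unique (key v (∑ i, α i)) (α := α) (by simp [multiIdx])
    rw [inner_zero_right]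
    refine (mul_eq_zero.1 h1).resolve_left ?_
    exact_mod_cast (Real.sqrt_pos.2 (k.aMulti_pos α)).ne'
  exact lp.ext (funext hc)

/-- `H_k ⊗ E` as a Hilbert space of `E`-valued functions on the ball. -/
instance : RKHS ℂ (HSpace k E) (Ball d) E where
  coeCLM := .pi fun z => HSpace.evalCLM k E z
  coeCLM_injective := by
    refine (injective_iff_map_eq_zero _).2 fun f hf => f.eq_zero_of_eval fun z => congrFun hf z

lemma HSpace.apply_eq (f : HSpace k E) (z : Ball d) :
    f z = ∑' α, k.basisFn z.1 α • f.coord α := rfl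

/-- The reproducing kernel of `H_k ⊗ E` is `k(z, w) I_E`. -/
theorem HSpace.kernel_eq (z w : Ball d) (v : E) :
    RKHS.kernel (HSpace k E) z w v = k.fn z w • v := by
  have hmem : Memℓp (fun α => star (k.basisFn w.1 α) • v) 2 := by
    rw [memℓp_gen_iff (by norm_num)]
    simp only [ENNReal.toReal_ofNat, Real.rpow_ofNat, norm_smul, mul_pow, norm_star]
    exact (k.summable_basisFn_sq w).mul_right _
  set g : HSpace k E := (⟨_, hmem⟩ : lp (fun _ : Fin d → ℕ => E) 2) with hg
  have hgk : RKHS.kerFun (HSpace k E) w v = g := by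
    refine ext_inner_right ℂ fun f => ?_
    rw [RKHS.kerFun_inner]
    have h1 : inner ℂ g f = ∑' α, inner ℂ (g.coord α) (f.coord α) := lp.inner_eq_tsum _ _
    have h2 := (innerSL ℂ v).hasSum (f.summable_eval w).hasSum
    rw [h1, HSpace.apply_eq]
    refine h2.tsum_eq.symm.trans (tsum_congr fun α => ?_)
    change inner ℂ v (k.basisFn w.1 α • f.coord α) =
      inner ℂ (star (k.basisFn w.1 α) • v) (f.coord α)
    rw [inner_smul_left, inner_smul_right]
    simp
  rw [← RKHS.kerFun_apply, hgk, HSpace.apply_eq, ← (k.hasSum_basisFn z w).tsum_eq,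
    ← (k.hasSum_basisFn z w).summable.tsum_smul_const]
  exact tsum_congr fun α => smul_smul _ _ _

end Space

/-! ### Multipliers and complete Nevanlinna-Pick kernels -/

section Multipliers

variable {d : ℕ}

/-- `φ`, an operator-valued function on the ball, is a multiplier from `H_l ⊗ E` to `H_k ⊗ F`, and
the bounded operator `M` is the operator `M_φ` of multiplication by `φ`. -/
def IsMulOp {l k : UIKernel d} {E F : Type*}
    [NormedAddCommGroup E] [InnerProductSpace ℂ E] [CompleteSpace E]
    [NormedAddCommGroup F] [InnerProductSpace ℂ F] [CompleteSpace F]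
    (φ : Ball d → E →L[ℂ] F) (M : HSpace l E →L[ℂ] HSpace k F) : Prop :=
  ∀ (f : HSpace l E) (z : Ball d), M f z = φ z (f z)

/-- The `M_{m × n}` Nevanlinna-Pick property: matrices `W₁, …, W_N` for which the block matrix
`[(I - Wᵢ Wⱼ*) s(λᵢ, λⱼ)]` is positive semi-definite are interpolated at `λ₁, …, λ_N` by a
contractive multiplier from `H_s ⊗ ℂⁿ` to `H_s ⊗ ℂᵐ`. -/
def UIKernel.HasNP (s : UIKernel d) (m n : ℕ) : Prop :=
  ∀ (N : ℕ) (pt : Fin N → Ball d) (W : Fin N → Matrix (Fin m) (Fin n) ℂ),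
    (Matrix.of fun p q : Fin N × Fin m =>
      (1 - W p.1 * (W q.1).conjTranspose : Matrix (Fin m) (Fin m) ℂ) p.2 q.2 * s.fn (pt p.1) (pt q.1)).PosSemidef →
    ∃ (φ : Ball d → EuclideanSpace ℂ (Fin n) →L[ℂ] EuclideanSpace ℂ (Fin m))
      (M : HSpace s (EuclideanSpace ℂ (Fin n)) →L[ℂ] HSpace s (EuclideanSpace ℂ (Fin m))),
      IsMulOp φ M ∧ ‖M‖ ≤ 1 ∧
        ∀ i, φ (pt i) = (Matrix.toEuclideanLin (W i)).toContinuousLinearMap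

/-- `H_s` is irreducible: `s` is nowhere zero, and kernel functions `s_w`, `s_v` at distinct points
are linearly independent. -/
def UIKernel.IsIrreducible (s : UIKernel d) : Prop :=
  (∀ z w : Ball d, s.fn z w ≠ 0) ∧
    ∀ w v : Ball d, w ≠ v → LinearIndependent ℂ ![fun z => s.fn z w, fun z => s.fn z v]

/-- `s` is a unitarily invariant complete Nevanlinna-Pick kernel. -/
def UIKernel.IsCNP (s : UIKernel d) : Prop :=
  s.IsIrreducible ∧ ∀ m n : ℕ, 0 < m → 0 < n → s.HasNP m n

/-- `g` is a positive (semi-definite) kernel on the ball. -/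
def IsPositiveKernel (g : Ball d → Ball d → ℂ) : Prop := (Matrix.of g).PosSemidef

end Multipliers

/-! ### Pure `1/k`-contractions and characteristic functions -/

section Operators

variable {d : ℕ} {H : Type u} [NormedAddCommGroup H] [InnerProductSpace ℂ H]

/-- `T^α = T₁^{α₁} ⋯ T_d^{α_d}`. -/
def tpow (T : Fin d → H →L[ℂ] H) (α : Fin d → ℕ) : H →L[ℂ] H :=
  (List.ofFn fun i => T i ^ α i).prod

/-- The series `∑_α A_α` over all multi-indices, summed by increasing degree `|α|`, converges to
`S` in the strong operator topology. -/
def HasStrongSum (A : (Fin d → ℕ) → H →L[ℂ] H) (S : H →L[ℂ] H) : Prop :=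
  ∀ x : H, Filter.Tendsto
    (fun N : ℕ => ∑ n ∈ Finset.range N, ∑ α ∈ multiIdx d n, A α x) Filter.atTop (nhds (S x))

variable [CompleteSpace H]

/-- `T` is a `1/k`-contraction: a commuting tuple of bounded operators for which
`∑_{α ≠ 0} b_α T^α (T^α)*` converges strongly to a contraction (the term at `α = 0` vanishes, as
`b_0 = 0`). -/
def IsInvContraction (k : UIKernel d) (T : Fin d → H →L[ℂ] H) : Prop :=
  (∀ i j, Commute (T i) (T j)) ∧
    ∃ S : H →L[ℂ] H,
      HasStrongSum (fun α => (k.bMulti α : ℂ) • (tpow T α ∘L (tpow T α).adjoint)) S ∧ ‖S‖ ≤ 1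

/-- The sum `∑_{α ≠ 0} b_α T^α (T^α)*` of a `1/k`-contraction. -/
def IsInvContraction.sum {k : UIKernel d} {T : Fin d → H →L[ℂ] H} (hT : IsInvContraction k T) :
    H →L[ℂ] H := hT.2.choose

/-- The defect operator `Δ_T = (I - ∑_{α ≠ 0} b_α T^α (T^α)*)^{1/2}`. -/
def IsInvContraction.defect {k : UIKernel d} {T : Fin d → H →L[ℂ] H}
    (hT : IsInvContraction k T) : H →L[ℂ] H := CFC.sqrt (1 - hT.sum)

lemma IsInvContraction.adjoint_defect {k : UIKernel d} {T : Fin d → H →L[ℂ] H}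
    (hT : IsInvContraction k T) : hT.defect.adjoint = hT.defect :=
  (IsSelfAdjoint.of_nonneg (CFC.sqrt_nonneg (1 - hT.sum))).adjoint_eq

lemma IsInvContraction.isSelfAdjoint_sum {k : UIKernel d} {T : Fin d → H →L[ℂ] H}
    (hT : IsInvContraction k T) : IsSelfAdjoint hT.sum := by
  rw [ContinuousLinearMap.isSelfAdjoint_iff_isSymmetric]
  intro x y
  have hl := Filter.Tendsto.inner (𝕜 := ℂ) (hT.2.choose_spec.1 x) (tendsto_const_nhds (x := y))
  have hr := Filter.Tendsto.inner (𝕜 := ℂ) (tendsto_const_nhds (x := x)) (hT.2.choose_spec.1 y)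
  refine tendsto_nhds_unique hl (hr.congr fun N => ?_)
  simp only [inner_sum, sum_inner]
  refine Finset.sum_congr rfl fun n _ => Finset.sum_congr rfl fun α _ => ?_
  simp [← ContinuousLinearMap.adjoint_inner_right]

/-- `Δ_T` is a positive operator with square `I - ∑_{α ≠ 0} b_α T^α (T^α)*`. -/
theorem IsInvContraction.defect_spec {k : UIKernel d} {T : Fin d → H →L[ℂ] H}
    (hT : IsInvContraction k T) :
    0 ≤ hT.defect ∧ hT.defect ∘L hT.defect = 1 - hT.sum := by
  refine ⟨CFC.sqrt_nonneg _, CFC.sqrt_mul_sqrt_self _ ?_⟩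
  have h1 := hT.isSelfAdjoint_sum.le_algebraMap_norm_self
  have h2 : algebraMap ℝ (H →L[ℂ] H) ‖hT.sum‖ ≤ algebraMap ℝ (H →L[ℂ] H) 1 :=
    algebraMap_mono _ hT.2.choose_spec.2
  rw [map_one] at h2
  exact sub_nonneg.2 (h1.trans h2)

/-- The Hilbert space `closure (Ran Δ_T)`. -/
abbrev IsInvContraction.defectSpace {k : UIKernel d} {T : Fin d → H →L[ℂ] H}
    (hT : IsInvContraction k T) : Submodule ℂ H :=
  (LinearMap.range hT.defect.toLinearMap).topologicalClosure

/-- The `1/k`-contraction `T` is pure: `∑_α a_α T^α Δ_T² (T^α)*` converges strongly to `I`. -/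
def IsInvContraction.IsPure {k : UIKernel d} {T : Fin d → H →L[ℂ] H}
    (hT : IsInvContraction k T) : Prop :=
  HasStrongSum
    (fun α => (k.aMulti α : ℂ) • (tpow T α ∘L (hT.defect ∘L hT.defect) ∘L (tpow T α).adjoint)) 1

section V

variable {k : UIKernel d} {T : Fin d → H →L[ℂ] H} {hT : IsInvContraction k T}

/-- The vector `Δ_T (T^α)* h` of `closure (Ran Δ_T)`, as a linear map in `h`. -/
def IsInvContraction.defectAdj (hT : IsInvContraction k T) (α : Fin d → ℕ) :
    H →ₗ[ℂ] hT.defectSpace :=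
  (hT.defect ∘L (tpow T α).adjoint).toLinearMap.codRestrict hT.defectSpace fun h =>
    Submodule.le_topologicalClosure _ (LinearMap.mem_range_self _ ((tpow T α).adjoint h))

set_option linter.unusedSimpArgs false in
lemma IsInvContraction.IsPure.hasSum (hp : hT.IsPure) (h : H) :
    HasSum (fun α => ‖((Real.sqrt (k.aMulti α) : ℂ)) • hT.defectAdj α h‖ ^ 2) (‖h‖ ^ 2) := by
  have ha : ∀ α, inner ℂ h (((k.aMulti α : ℂ) •
      (tpow T α ∘L (hT.defect ∘L hT.defect) ∘L (tpow T α).adjoint)) h) =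
      ((‖((Real.sqrt (k.aMulti α) : ℂ)) • hT.defectAdj α h‖ ^ 2 : ℝ) : ℂ) := by
    intro α
    have h1 : inner ℂ h (tpow T α (hT.defect (hT.defect ((tpow T α).adjoint h)))) =
        ((‖hT.defect ((tpow T α).adjoint h)‖ ^ 2 : ℝ) : ℂ) := by
      rw [← ContinuousLinearMap.adjoint_inner_left, ← ContinuousLinearMap.adjoint_inner_left,
        hT.adjoint_defect, inner_self_eq_norm_sq_to_K]
      push_cast; rfl
    have h2 : ‖hT.defectAdj α h‖ = ‖hT.defect ((tpow T α).adjoint h)‖ := rfl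
    rw [norm_smul, mul_pow, h2, Complex.norm_real, Real.norm_eq_abs, sq_abs,
      Real.sq_sqrt (k.aMulti_pos α).le, Complex.ofReal_mul, ← h1]
    simp
  have ht := Filter.Tendsto.inner (𝕜 := ℂ) (tendsto_const_nhds (x := h)) (hp h)
  simp only [inner_sum, ha, one_apply_eq_self, inner_self_eq_norm_sq_to_K] at ht
  have ht2 := (Complex.continuous_re.tendsto _).comp ht
  have ht3 : HasSum (fun n => ∑ α ∈ multiIdx d n,
      ‖((Real.sqrt (k.aMulti α) : ℂ)) • hT.defectAdj α h‖ ^ 2) (‖h‖ ^ 2) := by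
    rw [hasSum_iff_tendsto_nat_of_nonneg fun n => Finset.sum_nonneg fun _ _ => by positivity]
    convert ht2 using 1
    · funext N
      simp [← Complex.ofReal_sum, ← Complex.ofReal_pow]
    · congr 1
      simp [← Complex.ofReal_pow]
  have hs := summable_of_multiIdx (fun _ => by positivity) ht3.summable
  rw [← (hasSum_multiIdx hs.hasSum).unique ht3]
  exact hs.hasSum

lemma IsInvContraction.IsPure.memℓp (hp : hT.IsPure) (h : H) :
    Memℓp (fun α => ((Real.sqrt (k.aMulti α) : ℂ)) • hT.defectAdj α h) 2 := by
  rw [memℓp_gen_iff (by norm_num)]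
  simp only [ENNReal.toReal_ofNat, Real.rpow_ofNat]
  exact (hp.hasSum h).summable

/-- The isometry `V_T : H → H_k ⊗ closure (Ran Δ_T)`, `V_T h = ∑_α a_α z^α ⊗ Δ_T (T^α)* h`. -/
def IsInvContraction.IsPure.V (hp : hT.IsPure) : H →ₗᵢ[ℂ] HSpace k hT.defectSpace where
  toFun h := (⟨fun α => ((Real.sqrt (k.aMulti α) : ℂ)) • hT.defectAdj α h, hp.memℓp h⟩ : lp (fun _ : Fin d → ℕ => hT.defectSpace) 2)
  map_add' x y := by
    refine lp.ext (funext fun α => ?_)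
    change (Real.sqrt (k.aMulti α) : ℂ) • hT.defectAdj α (x + y) =
      (Real.sqrt (k.aMulti α) : ℂ) • hT.defectAdj α x +
        (Real.sqrt (k.aMulti α) : ℂ) • hT.defectAdj α y
    rw [map_add, smul_add]
  map_smul' c x := by
    refine lp.ext (funext fun α => ?_)
    change (Real.sqrt (k.aMulti α) : ℂ) • hT.defectAdj α (c • x) =
      c • (Real.sqrt (k.aMulti α) : ℂ) • hT.defectAdj α x
    rw [map_smul, smul_comm]
  norm_map' h := by
    refine (sq_eq_sq₀ (norm_nonneg _) (norm_nonneg _)).1 ?_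
    exact (HSpace.norm_sq _).unique (hp.hasSum h)

/-- The values of `V_T h`. -/
theorem IsInvContraction.IsPure.V_apply (hp : hT.IsPure) (h : H) (z : Ball d) :
    hp.V h z = ∑' α, ((k.aMulti α : ℂ) * monomial z.1 α) • hT.defectAdj α h := by
  rw [HSpace.apply_eq]
  refine tsum_congr fun α => ?_
  change k.basisFn z.1 α • (Real.sqrt (k.aMulti α) : ℂ) • hT.defectAdj α h = _
  rw [smul_smul]
  congr 1
  have hs : (Real.sqrt (k.aMulti α) : ℂ) * (Real.sqrt (k.aMulti α) : ℂ) = (k.aMulti α : ℂ) := by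
    rw [← Complex.ofReal_mul, Real.mul_self_sqrt (k.aMulti_pos α).le]
  simp only [UIKernel.basisFn]
  linear_combination monomial z.1 α * hs

/-- The pure `1/k`-contraction `T` admits a characteristic function through the kernel `l`: there
are a Hilbert space `E` and an analytic `B(E, closure (Ran Δ_T))`-valued function `θ` on the ball
that is a multiplier from `H_l ⊗ E` to `H_k ⊗ closure (Ran Δ_T)` with `I - V_T V_T* = M_θ M_θ*`. -/
def IsInvContraction.IsPure.AdmitsCharFn (hp : hT.IsPure) (l : UIKernel d) : Prop :=
  ∃ (E : Type u) (_ : NormedAddCommGroup E) (_ : InnerProductSpace ℂ E) (_ : CompleteSpace E)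
    (θ : EuclideanSpace ℂ (Fin d) → E →L[ℂ] hT.defectSpace)
    (M : HSpace l E →L[ℂ] HSpace k hT.defectSpace),
    AnalyticOnNhd ℂ θ (Ball d) ∧ IsMulOp (fun z : Ball d => θ z) M ∧
      1 - hp.V.toContinuousLinearMap ∘L hp.V.toContinuousLinearMap.adjoint = M ∘L M.adjoint

end V

end Operators

end CharFn

end

noncomputable section

namespace CharFn

/-! ### Positive operators -/

section Hilbert

variable {X Y : Type*} [NormedAddCommGroup X] [InnerProductSpace ℂ X] [CompleteSpace X]
  [NormedAddCommGroup Y] [InnerProductSpace ℂ Y] [CompleteSpace Y]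

/-! Write `D` for the closure of the range of `Δ_T`. The proof rests on two positivity facts.

First, the Nevanlinna-Pick property makes `1 - 1/s` a positive kernel
(`UIKernel.HasNP.posSemidef_one_sub_inv`). Since `1 - 1/s` is a power series in `⟨z, w⟩`, testing it
on roots of unity shows that every coefficient `b n` of `s` is nonnegative
(`coeff_nonneg_of_posSemidef`). Hence `1 - 1/s` is the Gram kernel of the scalars `√b_α conj(w^α)`
(`UIKernel.hasSum_rowCoeff`).

Second, because `k = s * g` with `g` positive, `k * (1 - 1/s) = k - g` is dominated by `k`. So `k_w
⊗ x ↦ (√b_α conj(w^α) k_w ⊗ x)_α` extends to a contraction `R` on `H_k ⊗ D` (`exists_rowOp`), the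
adjoint of the row of the operators of multiplication by `√b_α z^α`.

The components of `R` are weighted backward shifts (`coord_rowOp`), and `V_T` intertwines them with
the operators `√b_α (T^α)*`, so they preserve the range of `V_T`. Put `P = I - V_T V_T*`. Applying
`P` to every component of `R` gives an operator that kills the range of `V_T`, hence is dominated by
`P`, and the difference of the two quadratic forms is `B* B` for some `B`. On kernel functions the
kernel of `B* B` is the kernel of `P` times `1 - (1 - 1/s) = 1/s` (`exists_factorization`). Thus the
kernel of `P` is `s` times a Gram kernel, which gives `P = M M*` with `M` multiplication by `θ(z) =
ev_z ∘ B*` on `H_s ⊗ (H_k ⊗ D)` (`exists_mulOp_of_gram`). Analyticity of `θ` reduces to that of `z ↦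
ev_z` in operator norm (`exists_analytic_eval`). -/

open ContinuousLinearMap in
/-- A positive operator `Q` is a Gram operator: `⟨B x, B y⟩ = ⟨x, Q y⟩` for some `B`. -/
lemma exists_gram_of_nonneg {Q : X →L[ℂ] X} (hQ : 0 ≤ Q) :
    ∃ B : X →L[ℂ] X, ∀ x y, inner ℂ (B x) (B y) = inner ℂ x (Q y) := by
  refine ⟨CFC.sqrt Q, fun x y => ?_⟩
  have h1 : (CFC.sqrt Q).adjoint = CFC.sqrt Q :=
    (IsSelfAdjoint.of_nonneg (CFC.sqrt_nonneg Q)).adjoint_eq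
  have h2 : CFC.sqrt Q * CFC.sqrt Q = Q := CFC.sqrt_mul_sqrt_self Q hQ
  rw [← adjoint_inner_right, h1]
  conv_rhs => rw [← h2]
  rfl

open ContinuousLinearMap in
/-- If `‖A x‖ ≤ ‖C x‖` for all `x`, then `C* C - A* A = B* B` for some operator `B`. -/
lemma exists_sqrt_sub {Z : Type*} [NormedAddCommGroup Z] [InnerProductSpace ℂ Z] [CompleteSpace Z]
    (A : X →L[ℂ] Y) (C : X →L[ℂ] Z) (h : ∀ x, ‖A x‖ ≤ ‖C x‖) :
    ∃ B : X →L[ℂ] X, ∀ x y,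
      inner ℂ (B x) (B y) = inner ℂ (C x) (C y) - inner ℂ (A x) (A y) := by
  have hform : ∀ x y, inner ℂ x ((C.adjoint ∘L C - A.adjoint ∘L A) y) =
      inner ℂ (C x) (C y) - inner ℂ (A x) (A y) := fun x y => by
    simp [adjoint_inner_right]
  have hpos : 0 ≤ C.adjoint ∘L C - A.adjoint ∘L A := by
    rw [nonneg_iff_isPositive, isPositive_def']
    refine ⟨?_, fun x => ?_⟩
    · rw [isSelfAdjoint_iff']
      simp [adjoint_comp]
    · rw [reApplyInnerSelf_apply, inner_re_symm, hform, map_sub, inner_self_eq_norm_sq,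
        inner_self_eq_norm_sq]
      have := h x
      have h0 := norm_nonneg (A x)
      nlinarith
  obtain ⟨B, hB⟩ := exists_gram_of_nonneg hpos
  exact ⟨B, fun x y => (hB x y).trans (hform x y)⟩

end Hilbert

/-! ### Multipliers on kernel functions, and positivity of `1 - 1/s` -/

section Kernels

variable {d : ℕ}

/-- The reproducing property turns multiplication by `φ z` at a point into its adjoint on kernel
vectors. This is how contractivity of a multiplier becomes positivity of a kernel. -/
lemma IsMulOp.adjoint_kerFun {l k : UIKernel d} {E F : Type*}
    [NormedAddCommGroup E] [InnerProductSpace ℂ E] [CompleteSpace E]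
    [NormedAddCommGroup F] [InnerProductSpace ℂ F] [CompleteSpace F]
    {φ : Ball d → E →L[ℂ] F} {M : HSpace l E →L[ℂ] HSpace k F} (h : IsMulOp φ M) (z : Ball d)
    (x : F) : M.adjoint (RKHS.kerFun (HSpace k F) z x) =
      RKHS.kerFun (HSpace l E) z ((φ z).adjoint x) := by
  refine ext_inner_left ℂ fun f => ?_
  rw [ContinuousLinearMap.adjoint_inner_right, RKHS.inner_kerFun, RKHS.inner_kerFun, h,
    ContinuousLinearMap.adjoint_inner_right]

lemma inner_kerFun_kerFun {k : UIKernel d} {F : Type*} [NormedAddCommGroup F]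
    [InnerProductSpace ℂ F] [CompleteSpace F] (z w : Ball d) (x y : F) :
    inner ℂ (RKHS.kerFun (HSpace k F) z x) (RKHS.kerFun (HSpace k F) w y) =
      k.fn z w * inner ℂ x y := by
  rw [RKHS.kerFun_inner, RKHS.kerFun_apply, HSpace.kernel_eq, inner_smul_right]

variable (s : UIKernel d)

lemma UIKernel.fn_zero_left (z w : Ball d) (hz : z.1 = 0) : s.fn z w = 1 := by
  rw [UIKernel.fn, tsum_eq_single 0]
  · simp [s.coeff_zero]
  · intro n hn
    simp [hz, hn]

lemma UIKernel.star_fn (z w : Ball d) : star (s.fn z w) = s.fn w z := by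
  rw [UIKernel.fn, UIKernel.fn, tsum_star]
  refine tsum_congr fun n => ?_
  simp

lemma UIKernel.fn_ne_zero (z w : Ball d) : s.fn z w ≠ 0 := s.ne_zero z w

variable {s}

/-- Extension of a Gram representation of `1 - 1 / s` by one point, by the Nevanlinna-Pick property
for row matrices. -/
lemma UIKernel.HasNP.posSemidef_snoc (hs : ∀ n, 0 < n → s.HasNP 1 n) {N : ℕ}
    (pt : Fin (N + 2) → Ball d) (h0 : (pt 0).1 = 0)
    (ih : (Matrix.of fun i j : Fin (N + 1) =>
      1 - (s.fn (pt i.castSucc) (pt j.castSucc))⁻¹).PosSemidef) :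
    (Matrix.of fun i j => 1 - (s.fn (pt i) (pt j))⁻¹).PosSemidef := by
  obtain ⟨m, v, hv⟩ := Matrix.posSemidef_iff_eq_sum_vecMulVec.1 ih
  -- The extra zero column keeps the number of columns positive even if `m = 0`, as the
  -- Nevanlinna-Pick property requires. It does not change the products `W i * (W j)*`.
  let W : Fin (N + 1) → Matrix (Fin 1) (Fin (m + 1)) ℂ := fun i =>
    Matrix.of fun _ p => Fin.cases 0 (fun p => v p i) p
  have hW : ∀ i j, (W i * (W j).conjTranspose) 0 0 =
      1 - (s.fn (pt i.castSucc) (pt j.castSucc))⁻¹ := by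
    intro i j
    have := congrFun (congrFun hv i) j
    rw [Matrix.of_apply] at this
    rw [this, Matrix.mul_apply, Fin.sum_univ_succ, Matrix.sum_apply]
    simp [W, Matrix.vecMulVec_apply]
  obtain ⟨φ, M, hφ, hM, hint⟩ := hs (m + 1) m.succ_pos (N + 1) (fun i => pt i.castSucc) W (by
    -- The choice of `W` turns the Pick matrix `(1 - W i * (W j)*) * s` into the all-ones matrix.
    have : (Matrix.of fun p q : Fin (N + 1) × Fin 1 =>
        (1 - W p.1 * (W q.1).conjTranspose : Matrix (Fin 1) (Fin 1) ℂ) p.2 q.2 *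
          s.fn (pt p.1.castSucc) (pt q.1.castSucc)) =
        Matrix.vecMulVec (fun _ => 1) (star fun _ => 1) := by
      ext ⟨i, a⟩ ⟨j, b⟩
      obtain rfl := Subsingleton.elim a 0
      obtain rfl := Subsingleton.elim b 0
      rw [Matrix.of_apply, Matrix.sub_apply, hW]
      simp [Matrix.vecMulVec_apply, s.fn_ne_zero]
    rw [this]
    exact Matrix.posSemidef_vecMulVec_self_star _)
  set e : EuclideanSpace ℂ (Fin 1) := EuclideanSpace.single 0 1 with he
  have hee : inner ℂ e e = (1 : ℂ) := by simp [he]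
  let y : Fin (N + 2) → EuclideanSpace ℂ (Fin (m + 1)) := fun i => (φ (pt i)).adjoint e
  have hy : ∀ i j : Fin (N + 1), inner ℂ (y i.castSucc) (y j.castSucc) =
      1 - (s.fn (pt i.castSucc) (pt j.castSucc))⁻¹ := by
    have hyi : ∀ (i : Fin (N + 1)) p, y i.castSucc p = star (W i 0 p) := by
      intro i p
      have h1 : inner ℂ (EuclideanSpace.single p (1 : ℂ)) (y i.castSucc) = y i.castSucc p := by
        rw [EuclideanSpace.inner_single_left]; simp
      rw [← h1, ContinuousLinearMap.adjoint_inner_right, hint i]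
      simp [he, Matrix.toLpLin_apply, PiLp.inner_apply]
    intro i j
    rw [← hW, PiLp.inner_apply, Matrix.mul_apply]
    refine Finset.sum_congr rfl fun p _ => ?_
    simp [hyi, mul_comm]
  let K : Fin (N + 2) → HSpace s (EuclideanSpace ℂ (Fin 1)) := fun i => RKHS.kerFun _ (pt i) e
  -- Here `B* B = I - M M*`, so the vectors `B (K i)` have the Gram matrix `s * (1 - ⟨y i, y j⟩)`,
  -- at the new point as well.
  obtain ⟨B, hB⟩ := exists_sqrt_sub M.adjoint (ContinuousLinearMap.id ℂ _) (fun x => by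
    refine (M.adjoint.le_opNorm x).trans ?_
    rw [LinearIsometryEquiv.norm_map]
    exact mul_le_of_le_one_left (norm_nonneg _) hM)
  have hG : ∀ i j, inner ℂ (B (K i)) (B (K j)) = s.fn (pt i) (pt j) * (1 - inner ℂ (y i) (y j)) := by
    intro i j
    rw [hB, hφ.adjoint_kerFun, hφ.adjoint_kerFun, inner_kerFun_kerFun]
    simp only [ContinuousLinearMap.id_apply, K, inner_kerFun_kerFun, hee, y]
    ring
  have hG1 : ∀ i j : Fin (N + 1), inner ℂ (B (K i.castSucc)) (B (K j.castSucc)) = (1 : ℂ) := by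
    intro i j
    rw [hG, hy]
    simp [s.fn_ne_zero]
  -- Vectors whose Gram matrix is all ones coincide. Since `y 0 = 0` and `s(0, ·) = 1`, this common
  -- vector also has inner product one with `B (K last)`, which fixes every entry of the Gram matrix
  -- of `y` except the last diagonal one.
  have hconst : ∀ i : Fin (N + 1), B (K i.castSucc) = B (K 0) := by
    intro i
    rw [← sub_eq_zero, ← inner_self_eq_zero (𝕜 := ℂ)]
    have := hG1 0
    simp only [Fin.castSucc_zero] at this
    have h2 := fun i => hG1 i 0
    simp only [Fin.castSucc_zero] at h2
    have h3 := hG1 0 0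
    simp only [Fin.castSucc_zero] at h3
    rw [inner_sub_left, inner_sub_right, inner_sub_right, hG1, this, h2, h3]
    ring
  have hy0 : y 0 = 0 := by
    have := hy 0 0
    rw [Fin.castSucc_zero, s.fn_zero_left _ _ h0] at this
    simpa using this
  have hB0 : ∀ j, inner ℂ (B (K 0)) (B (K j)) = (1 : ℂ) := by
    intro j
    rw [hG, hy0, s.fn_zero_left _ _ h0]
    simp
  set last : Fin (N + 2) := Fin.last _
  have hrel : ∀ i j : Fin (N + 2), i ≠ last → inner ℂ (y i) (y j) = 1 - (s.fn (pt i) (pt j))⁻¹ := by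
    intro i j hi
    obtain ⟨i, rfl⟩ := Fin.exists_castSucc_eq.2 hi
    have h1 := hB0 j
    rw [← hconst i, hG] at h1
    have := s.fn_ne_zero (pt i.castSucc) (pt j)
    field_simp
    linear_combination -h1
  have hrel' : ∀ i j : Fin (N + 2), j ≠ last → inner ℂ (y i) (y j) = 1 - (s.fn (pt i) (pt j))⁻¹ := by
    intro i j hj
    rw [← inner_conj_symm, hrel j i hj, ← s.star_fn]
    simp
  -- The last diagonal entry satisfies only an inequality, obtained by expanding `‖B (K last) - B (K
  -- 0)‖² ≥ 0` and dividing by `s`.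
  have hlast : 0 ≤ 1 - (s.fn (pt last) (pt last))⁻¹ - inner ℂ (y last) (y last) := by
    have h1 : inner ℂ (B (K last) - B (K 0)) (B (K last) - B (K 0)) =
        s.fn (pt last) (pt last) * (1 - inner ℂ (y last) (y last)) - 1 := by
      have h2 : inner ℂ (B (K last)) (B (K 0)) = (1 : ℂ) := by
        rw [← inner_conj_symm, hB0]; simp
      simp only [inner_sub_left, inner_sub_right, h2, hB0, hG last last]
      ring
    have hpos : 0 ≤ s.fn (pt last) (pt last) := by
      have := inner_self_eq_norm_sq_to_K (𝕜 := ℂ) (K last)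
      simp only [K, inner_kerFun_kerFun, hee, mul_one] at this
      rw [this]
      positivity
    have h3 : 0 ≤ (s.fn (pt last) (pt last))⁻¹ * inner ℂ (B (K last) - B (K 0))
        (B (K last) - B (K 0)) := by
      refine mul_nonneg (inv_nonneg.2 hpos) ?_
      rw [inner_self_eq_norm_sq_to_K]
      positivity
    rw [h1] at h3
    convert h3 using 1
    have := s.fn_ne_zero (pt last) (pt last)
    field_simp
    ring
  -- The defect in the last diagonal entry is harmless: a Gram matrix plus a nonnegative diagonal
  -- matrix is positive.
  have hdecomp : (Matrix.of fun i j => 1 - (s.fn (pt i) (pt j))⁻¹) = Matrix.gram ℂ y +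
      Matrix.diagonal fun i => 1 - (s.fn (pt i) (pt i))⁻¹ - inner ℂ (y i) (y i) := by
    ext i j
    rw [Matrix.add_apply, Matrix.gram_apply, Matrix.of_apply, Matrix.diagonal_apply]
    split_ifs with hij
    · subst hij; ring
    · by_cases hi : i = last
      · rw [hrel' i j (fun hj => hij (hi.trans hj.symm)), add_zero]
      · rw [hrel i j hi, add_zero]
  rw [hdecomp]
  refine (Matrix.posSemidef_gram ℂ y).add (Matrix.PosSemidef.diagonal fun i => ?_)
  by_cases hi : i = last
  · rw [hi]; exact hlast
  · rw [hrel i i hi]; simp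

/-- For a complete Nevanlinna-Pick kernel `s`, normalized at the origin, `1 - 1 / s` is positive. -/
theorem UIKernel.HasNP.posSemidef_one_sub_inv (hs : ∀ n, 0 < n → s.HasNP 1 n) {N : ℕ}
    (pt : Fin N → Ball d) : (Matrix.of fun i j => 1 - (s.fn (pt i) (pt j))⁻¹).PosSemidef := by
  have key : ∀ (N : ℕ) (pt : Fin (N + 1) → Ball d), (pt 0).1 = 0 →
      (Matrix.of fun i j => 1 - (s.fn (pt i) (pt j))⁻¹).PosSemidef := by
    intro N
    induction N with
    | zero =>
      intro pt h0
      convert Matrix.PosSemidef.zero using 1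
      ext i j
      obtain rfl : i = 0 := Fin.fin_one_eq_zero i
      simp [s.fn_zero_left _ _ h0]
    | succ N ih =>
      intro pt h0
      exact UIKernel.HasNP.posSemidef_snoc hs pt h0 (ih (fun i => pt i.castSucc) h0)
  -- The origin is prepended to start the induction, then discarded by passing to a principal
  -- submatrix.
  have := (key N (Fin.cons ⟨0, by simp⟩ pt) rfl).submatrix Fin.succ
  simpa [Matrix.submatrix] using this

end Kernels

/-! ### Power series defining positive kernels -/

section Coefficients

open Filter Topology

variable {d : ℕ}

/-- The Fejér-type weights `|N⁻¹ ∑_{j < N} ω^{j (n - m)}|²`, with `ω` a primitive `N`-th root of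
unity, are bounded by one and single out the index `m` for large `N`. -/
lemma exists_root_weights (m N : ℕ) (hN : m < N) : ∃ ω : ℂ, ‖ω‖ = 1 ∧
    (∀ n, ‖∑ j ∈ Finset.range N, ((starRingEnd ℂ) (ω ^ m) * ω ^ n) ^ j‖ ≤ N) ∧
    (∑ j ∈ Finset.range N, ((starRingEnd ℂ) (ω ^ m) * ω ^ m) ^ j = N) ∧
    ∀ n < N, n ≠ m → ∑ j ∈ Finset.range N, ((starRingEnd ℂ) (ω ^ m) * ω ^ n) ^ j = 0 := by
  have hN0 : N ≠ 0 := by omega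
  have hω := Complex.isPrimitiveRoot_exp N hN0
  set ω := Complex.exp (2 * Real.pi * Complex.I / N)
  have h1 : ‖ω‖ = 1 := hω.norm'_eq_one hN0
  have hu : (starRingEnd ℂ) (ω ^ m) * ω ^ m = 1 := by
    rw [Complex.conj_mul', norm_pow, h1]; simp
  refine ⟨ω, h1, fun n => ?_, ?_, fun n hn hnm => ?_⟩
  · refine (norm_sum_le _ _).trans ?_
    simp [h1]
  · rw [hu]; simp
  · set ρ := (starRingEnd ℂ) (ω ^ m) * ω ^ n with hρ
    -- Primitivity of `ω` separates the exponents `m` and `n`, both below `N`; the geometric sum of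
    -- the nontrivial root of unity `ρ` then vanishes.
    have hρ1 : ρ ≠ 1 := by
      intro h
      refine hnm (hω.pow_inj hn hN ?_)
      have h2 : ω ^ m * ρ = ω ^ n := by
        rw [hρ]; linear_combination ω ^ n * hu
      rw [← h2, h, mul_one]
    have hρN : ρ ^ N = 1 := by
      have h3 : ω ^ N = 1 := hω.pow_eq_one
      rw [hρ, mul_pow, ← map_pow, ← pow_mul, ← pow_mul, mul_comm m, mul_comm n, pow_mul, pow_mul,
        h3]
      simp
    have := geom_sum_mul ρ N
    rw [hρN, sub_self] at this
    exact (mul_eq_zero.1 this).resolve_right (sub_ne_zero.2 hρ1)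

/-- If a function of `⟨z, w⟩` is a positive kernel on the ball, its Taylor coefficients at the
origin are nonnegative. -/
theorem coeff_nonneg_of_posSemidef (hd : 1 ≤ d) {c : ℕ → ℝ} {F : ℂ → ℂ}
    (hpos : ∀ (N : ℕ) (pt : Fin N → Ball d),
      (Matrix.of fun i j => F (inner ℂ (pt j).1 (pt i).1)).PosSemidef)
    (hF : ∀ᶠ t in 𝓝 (0 : ℂ), HasSum (fun n => t ^ n * (c n : ℂ)) (F t)) (m : ℕ) : 0 ≤ c m := by
  obtain ⟨ε, hε, hFε⟩ := Metric.eventually_nhds_iff.1 hF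
  obtain ⟨r, hr0, hr1⟩ := exists_between (lt_min hε one_pos)
  have hrε : r < ε := hr1.trans_le (min_le_left _ _)
  have hr1 : r < 1 := hr1.trans_le (min_le_right _ _)
  have hr2 : r ^ 2 < ε := by nlinarith
  have hsum : Summable fun n => ‖(c n * (r ^ 2) ^ n : ℝ)‖ := by
    have := (hFε (y := ((r ^ 2 : ℝ) : ℂ)) (by
      rw [dist_zero_right, Complex.norm_real, Real.norm_of_nonneg (by positivity)]; exact hr2)).summable
    refine this.norm.congr fun n => ?_
    rw [← Complex.ofReal_pow, ← Complex.ofReal_mul, Complex.norm_real, mul_comm]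
  -- The test points are `r ω^j` on one coordinate axis, with weights `ω^(m j)`. They number `m + 1
  -- + N`, so that `m` lies in the range where the roots of unity separate exponents.
  let i0 : Fin d := ⟨0, hd⟩
  choose ω hω1 hωle hωm hωz using fun N : ℕ => exists_root_weights m (m + 1 + N) (by omega)
  let w : ℕ → ℕ → ℝ := fun N n =>
    (‖∑ j ∈ Finset.range (m + 1 + N), ((starRingEnd ℂ) (ω N ^ m) * ω N ^ n) ^ j‖ / (m + 1 + N)) ^ 2
  have hw1 : ∀ N n, w N n ≤ 1 := by
    intro N n
    refine pow_le_one₀ (by positivity) ((div_le_one (by positivity)).2 ?_)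
    simpa using hωle N n
  have hw0 : ∀ N n, 0 ≤ w N n := fun N n => by positivity
  have hnonneg : ∀ N, 0 ≤ ∑' n, c n * (r ^ 2) ^ n * w N n := by
    intro N
    have hb : ∀ j : ℕ, EuclideanSpace.single i0 ((r : ℂ) * ω N ^ j) ∈ Ball d := by
      intro j
      simp [Ball, hω1, abs_of_pos hr0, hr1]
    have hp := (hpos (m + 1 + N) fun j => ⟨_, hb j⟩).dotProduct_mulVec_nonneg
      fun j => (ω N ^ m) ^ (j : ℕ)
    have hinner : ∀ i j : ℕ, inner ℂ (EuclideanSpace.single i0 ((r : ℂ) * ω N ^ j))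
        (EuclideanSpace.single i0 ((r : ℂ) * ω N ^ i)) =
        ((r ^ 2 : ℝ) : ℂ) * (ω N ^ i * (starRingEnd ℂ) (ω N ^ j)) := by
      intro i j
      rw [EuclideanSpace.inner_single_left]
      simp
      ring
    -- Expanding `F` at the points `r² ω^i conj(ω^j)` makes the quadratic form a series in `c n`
    -- whose weights are squared moduli of geometric sums.
    have hs : HasSum (fun n => ((c n * (r ^ 2) ^ n *
        ‖∑ j ∈ Finset.range (m + 1 + N), ((starRingEnd ℂ) (ω N ^ m) * ω N ^ n) ^ j‖ ^ 2 : ℝ) : ℂ))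
        (star (fun j : Fin (m + 1 + N) => (ω N ^ m) ^ (j : ℕ)) ⬝ᵥ
          (Matrix.of fun i j : Fin (m + 1 + N) => F (inner ℂ (EuclideanSpace.single i0 ((r : ℂ) * ω N ^ (j : ℕ)))
        (EuclideanSpace.single i0 ((r : ℂ) * ω N ^ (i : ℕ))))).mulVec
          fun j => (ω N ^ m) ^ (j : ℕ)) := by
      have hF' : ∀ i j : ℕ, HasSum (fun n => (((r ^ 2 : ℝ) : ℂ) *
          (ω N ^ i * (starRingEnd ℂ) (ω N ^ j))) ^ n * (c n : ℂ))
          (F (inner ℂ (EuclideanSpace.single i0 ((r : ℂ) * ω N ^ j))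
            (EuclideanSpace.single i0 ((r : ℂ) * ω N ^ i)))) := by
        intro i j
        rw [hinner]
        apply hFε
        rw [dist_zero_right]
        simpa [hω1] using hr2
      have := hasSum_sum (s := Finset.univ) fun (i : Fin (m + 1 + N)) _ =>
        (hasSum_sum (s := Finset.univ) fun (j : Fin (m + 1 + N)) _ =>
          (hF' i j).mul_right ((ω N ^ m) ^ (j : ℕ))).mul_left ((starRingEnd ℂ) ((ω N ^ m) ^ (i : ℕ)))
      refine HasSum.congr_fun (show HasSum _ (∑ i, _ * ∑ j, _) from this) fun n => ?_
      have hA : ∑ j ∈ Finset.range (m + 1 + N), ((starRingEnd ℂ) (ω N ^ m) * ω N ^ n) ^ j =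
          ∑ j : Fin (m + 1 + N), ((starRingEnd ℂ) (ω N ^ m) * ω N ^ n) ^ (j : ℕ) :=
        Finset.sum_range _
      rw [Complex.ofReal_mul, Complex.ofReal_pow, ← Complex.mul_conj', hA, map_sum,
        Finset.sum_mul_sum, Finset.mul_sum]
      refine Finset.sum_congr rfl fun i _ => ?_
      rw [Finset.mul_sum, Finset.mul_sum]
      refine Finset.sum_congr rfl fun j _ => ?_
      simp only [map_mul, map_pow, Complex.conj_conj, Complex.ofReal_mul, Complex.ofReal_pow, mul_pow]
      ring
    have h2 := (hs.mapL Complex.reCLM)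
    simp only [Complex.reCLM_apply, Complex.ofReal_re] at h2
    have h3 : (fun n => c n * (r ^ 2) ^ n * w N n) = fun n => (c n * (r ^ 2) ^ n *
        ‖∑ j ∈ Finset.range (m + 1 + N), ((starRingEnd ℂ) (ω N ^ m) * ω N ^ n) ^ j‖ ^ 2) /
          (m + 1 + N : ℝ) ^ 2 := by
      funext n
      simp only [w, div_pow]
      ring
    rw [h3, (h2.div_const _).tsum_eq]
    exact div_nonneg (Complex.nonneg_iff.1 hp).1 (by positivity)
  -- As the number of points grows, dominated convergence leaves only the term `c m * r^(2m)`.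
  have hlim : Tendsto (fun N => ∑' n, c n * (r ^ 2) ^ n * w N n) atTop
      (𝓝 (∑' n, if n = m then c m * (r ^ 2) ^ m else 0)) := by
    refine tendsto_tsum_of_dominated_convergence hsum (fun n => ?_) (Eventually.of_forall
      fun N n => ?_)
    · refine tendsto_const_nhds.congr' ?_
      filter_upwards [eventually_ge_atTop n] with N hN
      split_ifs with h
      · subst h
        have : w N n = 1 := by
          have hne : ((n : ℝ) + 1 + N) ≠ 0 := by positivity
          simp only [w, hωm]
          rw [Complex.norm_natCast]
          push_cast
          rw [div_self hne, one_pow]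
        rw [this, mul_one]
      · have : w N n = 0 := by
          simp only [w, hωz N n (by omega) h]
          simp
        rw [this, mul_zero]
    · rw [norm_mul, Real.norm_of_nonneg (hw0 N n)]
      exact mul_le_of_le_one_right (norm_nonneg _) (hw1 N n)
  rw [tsum_ite_eq] at hlim
  have := ge_of_tendsto' hlim hnonneg
  exact nonneg_of_mul_nonneg_left this (by positivity)

end Coefficients

/-! ### Generating functions and the coefficients of `1 - 1/s` -/

section Generating

open Filter Topology

variable {d : ℕ}

/-- The generating function `∑ₙ aₙ tⁿ` of a unitarily invariant kernel. -/
def UIKernel.gen (s : UIKernel d) (t : ℂ) : ℂ := ∑' n, (s.coeff n : ℂ) * t ^ n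

variable (s : UIKernel d)

lemma UIKernel.fn_eq_gen (z w : Ball d) : s.fn z w = s.gen (inner ℂ w.1 z.1) := rfl

/-- One coordinate axis suffices: splitting `t` as `(t / r) * r` with `‖t‖ < r < 1` keeps both
points in the ball. Convergence and nonvanishing on pairs of points thus pass to the whole disc. -/
lemma exists_inner_eq (hd : 1 ≤ d) {t : ℂ} (ht : ‖t‖ < 1) :
    ∃ z w : Ball d, inner ℂ w.1 z.1 = t := by
  obtain ⟨r, hr, hr1⟩ := exists_between ht
  have hr0 : 0 < r := (norm_nonneg t).trans_lt hr
  let i0 : Fin d := ⟨0, hd⟩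
  refine ⟨⟨EuclideanSpace.single i0 (t / r), ?_⟩, ⟨EuclideanSpace.single i0 (r : ℂ), ?_⟩, ?_⟩
  · simpa [Ball, abs_of_pos hr0, div_lt_one hr0] using hr
  · simpa [Ball, abs_of_pos hr0] using hr1
  · have : (r : ℂ) ≠ 0 := by exact_mod_cast hr0.ne'
    rw [EuclideanSpace.inner_single_left]
    simp
    field_simp

lemma UIKernel.hasSum_gen (hd : 1 ≤ d) {t : ℂ} (ht : ‖t‖ < 1) :
    HasSum (fun n => t ^ n * (s.coeff n : ℂ)) (s.gen t) := by
  obtain ⟨z, w, rfl⟩ := exists_inner_eq hd ht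
  exact (s.summable z w).hasSum.congr_fun fun n => mul_comm _ _

lemma UIKernel.gen_ne_zero (hd : 1 ≤ d) {t : ℂ} (ht : ‖t‖ < 1) : s.gen t ≠ 0 := by
  obtain ⟨z, w, rfl⟩ := exists_inner_eq hd ht
  exact s.ne_zero z w

lemma UIKernel.coeff_eq_sum_b (n : ℕ) : s.coeff n =
    ∑ ij ∈ Finset.HasAntidiagonal.antidiagonal n, s.coeff ij.1 * s.b ij.2 + if n = 0 then 1 else 0 := by
  have h0 : PowerSeries.constantCoeff (PowerSeries.mk s.coeff) ≠ 0 := by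
    simp [s.coeff_zero]
  have h1 : PowerSeries.mk s.coeff =
      PowerSeries.mk s.coeff * (1 - (PowerSeries.mk s.coeff)⁻¹) + 1 := by
    rw [mul_sub, PowerSeries.mul_inv_cancel _ h0]; ring
  have h2 := congrArg (PowerSeries.coeff n) h1
  rw [map_add, PowerSeries.coeff_mul, PowerSeries.coeff_mk, PowerSeries.coeff_one] at h2
  rw [h2]
  simp only [PowerSeries.coeff_mk, UIKernel.b]

lemma hasFPowerSeriesAt_of_hasSum {P : ℕ → ℂ} {F : ℂ → ℂ}
    (h : ∀ᶠ t in 𝓝 (0 : ℂ), HasSum (fun n => t ^ n * P n) (F t)) :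
    HasFPowerSeriesAt F (FormalMultilinearSeries.ofScalars ℂ P) 0 := by
  refine hasFPowerSeriesAt_iff.2 ?_
  filter_upwards [h] with t ht
  simpa [FormalMultilinearSeries.coeff_ofScalars] using ht

lemma coeff_unique {P Q : ℕ → ℂ} {F : ℂ → ℂ}
    (hP : ∀ᶠ t in 𝓝 (0 : ℂ), HasSum (fun n => t ^ n * P n) (F t))
    (hQ : ∀ᶠ t in 𝓝 (0 : ℂ), HasSum (fun n => t ^ n * Q n) (F t)) : P = Q := by
  have := (hasFPowerSeriesAt_of_hasSum hP).eq_formalMultilinearSeries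
    (hasFPowerSeriesAt_of_hasSum hQ)
  funext n
  have h2 := congrArg (fun p => FormalMultilinearSeries.coeff p n) this
  simpa [FormalMultilinearSeries.coeff_ofScalars] using h2

lemma hasSum_cauchyProduct {P Q : ℕ → ℂ} {t x y : ℂ} (hP : HasSum (fun n => t ^ n * P n) x)
    (hQ : HasSum (fun n => t ^ n * Q n) y) :
    HasSum (fun n => t ^ n * ∑ ij ∈ Finset.HasAntidiagonal.antidiagonal n, P ij.1 * Q ij.2) (x * y) := by
  have h1 := (summable_norm_sum_mul_antidiagonal_of_summable_norm hP.summable.norm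
    hQ.summable.norm).of_norm.hasSum
  rw [← tsum_mul_tsum_eq_tsum_sum_antidiagonal_of_summable_norm hP.summable.norm
    hQ.summable.norm, hP.tsum_eq, hQ.tsum_eq] at h1
  refine h1.congr_fun fun n => ?_
  rw [Finset.mul_sum]
  refine Finset.sum_congr rfl fun ij hij => ?_
  rw [← Finset.HasAntidiagonal.mem_antidiagonal.1 hij, pow_add]
  ring

/-- The numbers `b n` come from a formal inverse. The analytic inverse of `gen` has a Taylor series
whose Cauchy product with that of `gen` is `1`, so uniqueness of formal inverses identifies the two.
Without sign information on `b` this yields convergence only near zero. -/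
lemma UIKernel.eventually_hasSum_b (hd : 1 ≤ d) :
    ∀ᶠ t in 𝓝 (0 : ℂ), HasSum (fun n => t ^ n * (s.b n : ℂ)) (1 - (s.gen t)⁻¹) := by
  have hball : ∀ᶠ t in 𝓝 (0 : ℂ), ‖t‖ < 1 := by
    filter_upwards [Metric.ball_mem_nhds (0 : ℂ) one_pos] with t ht using by simpa using ht
  have hgen : ∀ᶠ t in 𝓝 (0 : ℂ), HasSum (fun n => t ^ n * (s.coeff n : ℂ)) (s.gen t) :=
    hball.mono fun t ht => s.hasSum_gen hd ht
  obtain ⟨q, hq⟩ := (hasFPowerSeriesAt_of_hasSum hgen).analyticAt.inv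
    (s.gen_ne_zero hd (by simp))
  have hq' := hasFPowerSeriesAt_iff.1 hq
  simp only [zero_add, smul_eq_mul] at hq'
  have hδ : ∀ t : ℂ, HasSum (fun n => t ^ n * (if n = 0 then 1 else 0 : ℂ)) 1 := by
    intro t
    have := hasSum_ite_eq (0 : ℕ) (1 : ℂ)
    refine this.congr_fun fun n => ?_
    split_ifs with h <;> simp [h]
  have hprod : (fun n => ∑ ij ∈ Finset.HasAntidiagonal.antidiagonal n, (s.coeff ij.1 : ℂ) * q.coeff ij.2) =
      fun n => if n = 0 then 1 else 0 := by
    refine coeff_unique (F := fun _ => 1) ?_ (Eventually.of_forall hδ)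
    filter_upwards [hgen, hq', hball] with t h1 h2 h3
    have := hasSum_cauchyProduct h1 h2
    rwa [Pi.inv_apply, mul_inv_cancel₀ (s.gen_ne_zero hd h3)] at this
  have hb : ∀ n, q.coeff n = (if n = 0 then 1 else 0) - (s.b n : ℂ) := by
    have h1 : PowerSeries.mk (fun n => (s.coeff n : ℂ)) * PowerSeries.mk q.coeff = 1 := by
      ext n
      rw [PowerSeries.coeff_mul, PowerSeries.coeff_one, ← congrFun hprod n]
      simp
    have h2 : PowerSeries.mk (fun n => (s.coeff n : ℂ)) *
        PowerSeries.mk (fun n => (if n = 0 then 1 else 0) - (s.b n : ℂ)) = 1 := by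
      ext n
      have h3 := congrArg (fun x : ℝ => (x : ℂ)) (s.coeff_eq_sum_b n)
      rw [PowerSeries.coeff_mul, PowerSeries.coeff_one]
      simp only [PowerSeries.coeff_mk, mul_sub, Finset.sum_sub_distrib]
      have h4 : ∑ ij ∈ Finset.HasAntidiagonal.antidiagonal n, (s.coeff ij.1 : ℂ) * (if ij.2 = 0 then 1 else 0) =
          s.coeff n := by
        rw [Finset.sum_eq_single (n, 0)]
        · simp
        · rintro ⟨i, j⟩ hij hne
          have : j ≠ 0 := by
            rintro rfl
            exact hne (by simpa using Finset.HasAntidiagonal.mem_antidiagonal.1 hij)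
          simp [this]
        · simp
      rw [h4]
      split_ifs at h3 ⊢ <;> push_cast at h3 <;> linear_combination h3
    have hne : PowerSeries.mk (fun n => (s.coeff n : ℂ)) ≠ 0 := by
      intro h; rw [h, zero_mul] at h1; exact zero_ne_one h1
    have h5 := mul_left_cancel₀ hne (h1.trans h2.symm)
    intro n
    simpa using congrArg (PowerSeries.coeff n) h5
  filter_upwards [hq'] with t ht
  refine ((hδ t).sub ht).congr_fun fun n => ?_
  rw [hb]
  ring

/-- The coefficients of `1 - 1 / s` are nonnegative for a complete Nevanlinna-Pick kernel `s`. -/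
theorem UIKernel.HasNP.b_nonneg {s : UIKernel d} (hd : 1 ≤ d) (hs : ∀ n, 0 < n → s.HasNP 1 n)
    (n : ℕ) : 0 ≤ s.b n :=
  coeff_nonneg_of_posSemidef hd (F := fun t => 1 - (s.gen t)⁻¹)
    (fun _ pt => UIKernel.HasNP.posSemidef_one_sub_inv hs pt) (s.eventually_hasSum_b hd) n

variable {s}

/-- If the coefficients `bₙ` are nonnegative, then `∑ bₙ tⁿ = 1 - 1 / ∑ aₙ tⁿ` on the unit disc. -/
theorem UIKernel.hasSum_b (hd : 1 ≤ d) (hb : ∀ n, 0 ≤ s.b n) {t : ℂ} (ht : ‖t‖ < 1) :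
    HasSum (fun n => t ^ n * (s.b n : ℂ)) (1 - (s.gen t)⁻¹) := by
  -- With `b ≥ 0` and `a₀ = 1`, the recursion for `s.coeff n` contains `s.b n` among nonnegative
  -- terms, so the series of `b` converges wherever that of `a` does.
  have hle : ∀ n, s.b n ≤ s.coeff n := by
    intro n
    rw [s.coeff_eq_sum_b n]
    have h1 : s.coeff 0 * s.b n ≤ ∑ ij ∈ Finset.HasAntidiagonal.antidiagonal n, s.coeff ij.1 * s.b ij.2 :=
      Finset.single_le_sum (f := fun ij : ℕ × ℕ => s.coeff ij.1 * s.b ij.2)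
        (fun ij _ => mul_nonneg (s.coeff_pos _).le (hb _))
        (show (0, n) ∈ Finset.HasAntidiagonal.antidiagonal n by simp)
    rw [s.coeff_zero, one_mul] at h1
    split_ifs <;> linarith
  have hg := s.hasSum_gen hd ht
  have hsum : Summable fun n => t ^ n * (s.b n : ℂ) := by
    refine Summable.of_norm_bounded hg.summable.norm fun n => ?_
    rw [norm_mul, norm_mul, Complex.norm_real, Complex.norm_real, Real.norm_of_nonneg (hb n),
      Real.norm_of_nonneg (s.coeff_pos n).le]
    exact mul_le_mul_of_nonneg_left (hle n) (norm_nonneg _)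
  have hprod := hasSum_cauchyProduct hg hsum.hasSum
  have hδ := hasSum_ite_eq (0 : ℕ) (1 : ℂ)
  -- Summing the recursion gives `gen = gen * ∑ bₙ tⁿ + 1`.
  have h1 := hg.unique ((hprod.add hδ).congr_fun fun n => by
    rw [s.coeff_eq_sum_b n]
    split_ifs with h <;> simp [h])
  have hne := s.gen_ne_zero hd ht
  have h2 : ∑' n, t ^ n * (s.b n : ℂ) = 1 - (s.gen t)⁻¹ := by
    field_simp
    linear_combination -h1
  rw [← h2]
  exact hsum.hasSum

end Generating

section KernelOperators

universe u v

variable {d : ℕ}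

/-! ### Operators defined on kernel functions -/

section Dense

variable {k : UIKernel d} {D : Type u} [NormedAddCommGroup D] [InnerProductSpace ℂ D]
  [CompleteSpace D]

variable (k D) in
/-- The linear combination `∑ k(·, w) x_w` of kernel functions. -/
def kerSum : (Ball d →₀ D) →ₗ[ℂ] HSpace k D :=
  Finsupp.lsum ℂ fun w => (RKHS.kerFun (HSpace k D) w).toLinearMap

lemma denseRange_kerSum : DenseRange (kerSum k D) := by
  have h1 : Dense (Submodule.span ℂ {RKHS.kerFun (HSpace k D) x v | (x) (v)} : Set (HSpace k D)) :=
    Submodule.dense_iff_topologicalClosure_eq_top.2 (RKHS.kerFun_dense _)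
  refine Dense.mono ?_ h1
  rw [← LinearMap.coe_range, SetLike.coe_subset_coe, Submodule.span_le]
  rintro _ ⟨w, x, rfl⟩
  exact ⟨Finsupp.single w x, by simp [kerSum]⟩

lemma clm_ext_kerFun {Y : Type*} [NormedAddCommGroup Y] [NormedSpace ℂ Y]
    {A B : HSpace k D →L[ℂ] Y}
    (h : ∀ w x, A (RKHS.kerFun (HSpace k D) w x) = B (RKHS.kerFun (HSpace k D) w x)) : A = B := by
  refine ContinuousLinearMap.ext_on
    (Submodule.dense_iff_topologicalClosure_eq_top.2 (RKHS.kerFun_dense (HSpace k D))) ?_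
  rintro _ ⟨w, x, rfl⟩
  exact h w x

/-- A contractive assignment on linear combinations of kernel functions extends to a contraction. -/
lemma exists_clm_of_kerFun {Y : Type*} [NormedAddCommGroup Y] [NormedSpace ℂ Y] [CompleteSpace Y]
    (v : Ball d → D →ₗ[ℂ] Y) (h : ∀ x, ‖Finsupp.lsum ℂ v x‖ ≤ ‖kerSum k D x‖) :
    ∃ A : HSpace k D →L[ℂ] Y, (∀ f, ‖A f‖ ≤ ‖f‖) ∧
      ∀ w x, A (RKHS.kerFun (HSpace k D) w x) = v w x := by
  have h' : ∀ x, ‖Finsupp.lsum ℂ v x‖ ≤ 1 * ‖kerSum k D x‖ := by simpa using h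
  refine ⟨(Finsupp.lsum ℂ v).extendOfNorm (kerSum k D), fun f => ?_, fun w x => ?_⟩
  · simpa using LinearMap.norm_extendOfNorm_apply_le denseRange_kerSum 1 h' f
  · have := LinearMap.extendOfNorm_eq denseRange_kerSum ⟨1, h'⟩ (Finsupp.single w x)
    simpa [kerSum] using this

lemma inner_lsum {ι F Y : Type*} [AddCommGroup F] [Module ℂ F] [NormedAddCommGroup Y]
    [InnerProductSpace ℂ Y] (v : ι → F →ₗ[ℂ] Y) (x : ι →₀ F) :
    inner ℂ (Finsupp.lsum ℂ v x) (Finsupp.lsum ℂ v x) =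
      ∑ z ∈ x.support, ∑ w ∈ x.support, inner ℂ (v z (x z)) (v w (x w)) := by
  simp only [Finsupp.lsum_apply, Finsupp.sum, sum_inner, inner_sum]
  exact Finset.sum_comm

/-- The Schur product of a positive kernel with a Gram kernel is positive. -/
lemma IsPositiveKernel.sum_inner_nonneg {F : Type*} [NormedAddCommGroup F]
    [InnerProductSpace ℂ F] {g : Ball d → Ball d → ℂ} (hg : IsPositiveKernel g)
    (t : Finset (Ball d)) (x : Ball d → F) :
    0 ≤ ∑ z ∈ t, ∑ w ∈ t, g z w * inner ℂ (x z) (x w) := by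
  -- Writing `g` on the finite set as a sum of rank-one kernels turns the double sum into a sum of
  -- squared norms.
  obtain ⟨m, v, hv⟩ := Matrix.posSemidef_iff_eq_sum_vecMulVec.1
    (hg.submatrix (fun i : t => (i : Ball d)))
  have hv' : ∀ i j : t, g i j = ∑ p, v p i * (starRingEnd ℂ) (v p j) := by
    intro i j
    have := congrFun (congrFun hv i) j
    simpa [Matrix.sum_apply, Matrix.vecMulVec_apply] using this
  have hsum : ∑ z ∈ t, ∑ w ∈ t, g z w * inner ℂ (x z) (x w) =
      ∑ p, inner ℂ (∑ i : t, (starRingEnd ℂ) (v p i) • x i)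
        (∑ i : t, (starRingEnd ℂ) (v p i) • x i) := by
    simp only [sum_inner, inner_sum, inner_smul_left, inner_smul_right, Complex.conj_conj,
      Finset.mul_sum]
    have hsub : ∑ z ∈ t, ∑ w ∈ t, g z w * inner ℂ (x z) (x w) =
        ∑ i : t, ∑ j : t, g i j * inner ℂ (x i) (x j) := by
      rw [← Finset.sum_coe_sort]
      exact Finset.sum_congr rfl fun i _ =>
        (Finset.sum_coe_sort t fun w => g i w * inner ℂ (x i) (x w)).symm
    rw [hsub]
    symm
    rw [Finset.sum_comm]
    refine (Finset.sum_congr rfl fun j _ => ?_).trans Finset.sum_comm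
    rw [Finset.sum_comm]
    refine Finset.sum_congr rfl fun i _ => ?_
    rw [hv', Finset.sum_mul]
    exact Finset.sum_congr rfl fun p _ => by ring
  rw [hsum]
  refine Finset.sum_nonneg fun p _ => ?_
  rw [inner_self_eq_norm_sq_to_K]
  positivity

end Dense

/-! ### The row operator of a complete Nevanlinna-Pick kernel -/

section Row

variable (s : UIKernel d)

/-- The scalars `√b_α conj(w^α)`. -/
def UIKernel.rowCoeff (w : EuclideanSpace ℂ (Fin d)) (α : Fin d → ℕ) : ℂ :=
  (Real.sqrt (s.bMulti α) : ℂ) * star (monomial w α)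

variable {s}

lemma UIKernel.sum_rowCoeff (hb : ∀ n, 0 ≤ s.b n) (z w : EuclideanSpace ℂ (Fin d)) (n : ℕ) :
    ∑ α ∈ multiIdx d n, (starRingEnd ℂ) (s.rowCoeff z α) * s.rowCoeff w α =
      inner ℂ w z ^ n * (s.b n : ℂ) := by
  rw [inner_pow_eq, Finset.sum_mul]
  refine Finset.sum_congr rfl fun α hα => ?_
  have hn : ∑ i, α i = n := by simpa [multiIdx] using hα
  have hs : (Real.sqrt (s.bMulti α) : ℂ) * (Real.sqrt (s.bMulti α) : ℂ) =
      (s.b n : ℂ) * (multinom α : ℂ) := by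
    have h0 : 0 ≤ s.bMulti α := mul_nonneg (hb _) (Nat.cast_nonneg _)
    rw [← Complex.ofReal_mul, Real.mul_self_sqrt h0, UIKernel.bMulti, hn]
    push_cast; rfl
  simp only [UIKernel.rowCoeff, map_mul, Complex.star_def, Complex.conj_ofReal, Complex.conj_conj]
  linear_combination (monomial z α * (starRingEnd ℂ) (monomial w α)) * hs

lemma norm_inner_lt_one (z w : Ball d) : ‖inner ℂ w.1 z.1‖ < 1 := by
  have hz := z.2
  have hw := w.2
  simp only [Ball, Metric.mem_ball, dist_zero_right] at hz hw
  refine (norm_inner_le_norm _ _).trans_lt ?_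
  nlinarith [norm_nonneg z.1, norm_nonneg w.1]

lemma UIKernel.summable_rowCoeff_sq (hd : 1 ≤ d) (hb : ∀ n, 0 ≤ s.b n) (w : Ball d) :
    Summable fun α => ‖s.rowCoeff w.1 α‖ ^ 2 := by
  refine summable_of_multiIdx (fun _ => by positivity) ?_
  refine (UIKernel.hasSum_b hd hb (norm_inner_lt_one w w)).summable.norm.congr fun n => ?_
  rw [← UIKernel.sum_rowCoeff hb]
  simp only [Complex.conj_mul', ← Complex.ofReal_pow, ← Complex.ofReal_sum, Complex.norm_real,
    Real.norm_eq_abs]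
  exact abs_of_nonneg (Finset.sum_nonneg fun _ _ => by positivity)

/-- Grouping by degree and expanding `⟨z, w⟩ⁿ` by the multinomial formula gives `∑ bₙ ⟨z, w⟩ⁿ`. The
nonnegativity of `b` enters through the square roots. -/
lemma UIKernel.hasSum_rowCoeff (hd : 1 ≤ d) (hb : ∀ n, 0 ≤ s.b n) (z w : Ball d) :
    HasSum (fun α => (starRingEnd ℂ) (s.rowCoeff z.1 α) * s.rowCoeff w.1 α)
      (1 - (s.fn z w)⁻¹) := by
  have hs : Summable fun α => (starRingEnd ℂ) (s.rowCoeff z.1 α) * s.rowCoeff w.1 α := by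
    refine Summable.of_norm ?_
    simp only [norm_mul, RCLike.norm_conj]
    exact summable_norm_mul (UIKernel.summable_rowCoeff_sq hd hb z)
      (UIKernel.summable_rowCoeff_sq hd hb w) (fun _ => norm_nonneg _) (fun _ => norm_nonneg _)
  have h := hasSum_multiIdx hs.hasSum
  simp only [UIKernel.sum_rowCoeff hb] at h
  rw [UIKernel.fn_eq_gen, (UIKernel.hasSum_b hd hb (norm_inner_lt_one z w)).unique h]
  exact hs.hasSum

/-- For a square summable scalar family `c`, the operator `y ↦ (c_α y)_α`. -/
lemma exists_column {ι X : Type*} [NormedAddCommGroup X] [InnerProductSpace ℂ X] {c : ι → ℂ}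
    (hc : Summable fun α => ‖c α‖ ^ 2) :
    ∃ C : X →ₗ[ℂ] lp (fun _ : ι => X) 2, ∀ y α, C y α = c α • y := by
  have hmem : ∀ y : X, Memℓp (fun α => c α • y) 2 := by
    intro y
    rw [memℓp_gen_iff (by norm_num)]
    simp only [ENNReal.toReal_ofNat, Real.rpow_ofNat, norm_smul, mul_pow]
    exact hc.mul_right _
  exact ⟨{ toFun := fun y => ⟨_, hmem y⟩
           map_add' := fun x y => lp.ext (funext fun α => smul_add _ _ _)
           map_smul' := fun r x => lp.ext (funext fun α => smul_comm _ _ _) }, fun _ _ => rfl⟩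

variable {k : UIKernel d} {D : Type u} [NormedAddCommGroup D] [InnerProductSpace ℂ D]
  [CompleteSpace D]

/-- If `k / s` is a positive kernel, the adjoint of the row of the multiplication operators
`√b_α z^α` is a contraction on `H_k ⊗ D`. -/
theorem exists_rowOp (hd : 1 ≤ d) (hb : ∀ n, 0 ≤ s.b n) {g : Ball d → Ball d → ℂ}
    (hg : IsPositiveKernel g) (hk : ∀ z w, k.fn z w = s.fn z w * g z w) :
    ∃ R : HSpace k D →L[ℂ] lp (fun _ : Fin d → ℕ => HSpace k D) 2, (∀ f, ‖R f‖ ≤ ‖f‖) ∧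
      ∀ w x α, R (RKHS.kerFun (HSpace k D) w x) α =
        s.rowCoeff w.1 α • RKHS.kerFun (HSpace k D) w x := by
  choose C hC using fun w : Ball d => exists_column (X := HSpace k D)
    (UIKernel.summable_rowCoeff_sq hd hb w)
  obtain ⟨R, hR, hR'⟩ := exists_clm_of_kerFun (k := k)
    (fun w => C w ∘ₗ (RKHS.kerFun (HSpace k D) w).toLinearMap) (fun x => by
      have hin : ∀ z w a b, inner ℂ (C z (RKHS.kerFun (HSpace k D) z a))
          (C w (RKHS.kerFun (HSpace k D) w b)) =
          inner ℂ (RKHS.kerFun (HSpace k D) z a) (RKHS.kerFun (HSpace k D) w b) -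
            g z w * inner ℂ a b := by
        intro z w a b
        have h1 := lp.hasSum_inner (𝕜 := ℂ) (C z (RKHS.kerFun (HSpace k D) z a))
          (C w (RKHS.kerFun (HSpace k D) w b))
        simp only [hC, inner_smul_left, inner_smul_right, ← mul_assoc] at h1
        have h2 := (UIKernel.hasSum_rowCoeff hd hb z w).mul_right
          (inner ℂ (RKHS.kerFun (HSpace k D) z a) (RKHS.kerFun (HSpace k D) w b))
        rw [h1.unique (h2.congr_fun fun α => by ring), inner_kerFun_kerFun, hk]
        have := s.fn_ne_zero z w
        field_simp
      have h1 := inner_lsum (fun w => C w ∘ₗ (RKHS.kerFun (HSpace k D) w).toLinearMap) x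
      have h2 := inner_lsum (fun w => (RKHS.kerFun (HSpace k D) w).toLinearMap) x
      simp only [LinearMap.comp_apply, ContinuousLinearMap.coe_coe, hin,
        Finset.sum_sub_distrib] at h1 h2
      rw [← h2] at h1
      have h3 := hg.sum_inner_nonneg x.support x
      rw [← sub_eq_iff_eq_add.2 (sub_eq_iff_eq_add'.1 h1.symm)] at h3
      rw [inner_self_eq_norm_sq_to_K, inner_self_eq_norm_sq_to_K] at h3
      have h4 := (Complex.nonneg_iff.1 h3).1
      rw [← sq_le_sq₀ (norm_nonneg _) (norm_nonneg _)]
      simp only [RCLike.ofReal_eq_complex_ofReal, ← Complex.ofReal_pow, Complex.sub_re, Complex.ofReal_re] at h4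
      exact sub_nonneg.1 h4)
  refine ⟨R, hR, fun w x α => ?_⟩
  rw [hR']
  exact hC _ _ _

lemma HSpace.ext_coord {E : Type v} [NormedAddCommGroup E] {f f' : HSpace k E}
    (h : ∀ α, f.coord α = f'.coord α) : f = f' :=
  lp.ext (funext h)

/-- The element `√a_β z^β ⊗ y` of `H_k ⊗ D`. -/
def HSpace.single {E : Type v} [NormedAddCommGroup E] (k : UIKernel d) (β : Fin d → ℕ) (y : E) :
    HSpace k E :=
  (lp.single 2 β y : lp (fun _ : Fin d → ℕ => E) 2)

lemma HSpace.inner_single {E : Type v} [NormedAddCommGroup E] [InnerProductSpace ℂ E]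
    (β : Fin d → ℕ) (y : E) (f : HSpace k E) :
    inner ℂ (HSpace.single k β y) f = inner ℂ y (f.coord β) :=
  lp.inner_single_left (𝕜 := ℂ) (G := fun _ : Fin d → ℕ => E) β y f

lemma HSpace.coord_kerFun (w : Ball d) (x : D) (β : Fin d → ℕ) :
    (RKHS.kerFun (HSpace k D) w x).coord β = star (k.basisFn w.1 β) • x := by
  refine ext_inner_left ℂ fun y => ?_
  rw [← HSpace.inner_single, RKHS.inner_kerFun, HSpace.apply_eq, tsum_eq_single β, inner_smul_right]
  · have : (HSpace.single k β y).coord β = y := lp.single_apply_self (E := fun _ : Fin d → ℕ => D) 2 β y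
    rw [this, inner_smul_left]; rfl
  · intro α hα
    have : (HSpace.single k β y).coord α = 0 := lp.single_apply_ne (E := fun _ : Fin d → ℕ => D) 2 β y hα
    rw [this, smul_zero]

lemma monomial_add (z : EuclideanSpace ℂ (Fin d)) (α β : Fin d → ℕ) :
    monomial z (α + β) = monomial z α * monomial z β := by
  simp [monomial, pow_add, Finset.prod_mul_distrib]

/-- The coefficients of the components of the row operator. -/
lemma coord_rowOp {R : HSpace k D →L[ℂ] lp (fun _ : Fin d → ℕ => HSpace k D) 2}
    (hR : ∀ w x α, R (RKHS.kerFun (HSpace k D) w x) α =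
      s.rowCoeff w.1 α • RKHS.kerFun (HSpace k D) w x) (f : HSpace k D) (α β : Fin d → ℕ) :
    HSpace.coord (R f α) β = (Real.sqrt (s.bMulti α) *
      (Real.sqrt (k.aMulti β) / Real.sqrt (k.aMulti (α + β))) : ℂ) • f.coord (α + β) := by
  let π : (β : Fin d → ℕ) → HSpace k D →L[ℂ] D := fun β =>
    lp.evalCLM ℂ (fun _ : Fin d → ℕ => D) 2 β
  have : π β ∘L (lp.evalCLM ℂ (fun _ : Fin d → ℕ => HSpace k D) 2 α) ∘L R =
      (Real.sqrt (s.bMulti α) *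
      (Real.sqrt (k.aMulti β) / Real.sqrt (k.aMulti (α + β))) : ℂ) • π (α + β) := by
    -- Both sides are continuous in `f`, so kernel functions suffice; there the factor `conj(w^α)`
    -- raises the index from `β` to `α + β`.
    refine clm_ext_kerFun fun w x => ?_
    change HSpace.coord (R (RKHS.kerFun (HSpace k D) w x) α) β =
      (Real.sqrt (s.bMulti α) *
      (Real.sqrt (k.aMulti β) / Real.sqrt (k.aMulti (α + β))) : ℂ) • HSpace.coord (RKHS.kerFun (HSpace k D) w x) (α + β)
    rw [hR]
    change s.rowCoeff w.1 α • HSpace.coord (RKHS.kerFun (HSpace k D) w x) β = _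
    rw [HSpace.coord_kerFun, HSpace.coord_kerFun, smul_smul, smul_smul]
    congr 1
    have hne : (Real.sqrt (k.aMulti (α + β)) : ℂ) ≠ 0 := by
      exact_mod_cast (Real.sqrt_pos.2 (k.aMulti_pos _)).ne'
    simp only [UIKernel.rowCoeff, UIKernel.basisFn, monomial_add, star_mul', Complex.star_def,
      Complex.conj_ofReal]
    field_simp
  exact congrArg (fun A : HSpace k D →L[ℂ] D => A f) this

end Row

end KernelOperators

section Words

universe u v

variable {d : ℕ}

/-! ### Analyticity of the evaluation operators -/

/-- The multi-index counting the letters of a word in `Fin d`. -/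
def letterCount {n : ℕ} (w : Fin n → Fin d) (i : Fin d) : ℕ :=
  (Finset.univ.filter fun j => w j = i).card

lemma letterCount_mem {n : ℕ} (w : Fin n → Fin d) : letterCount w ∈ multiIdx d n := by
  have := Finset.card_eq_sum_card_fiberwise (f := w) (s := Finset.univ) (t := Finset.univ)
    (fun _ _ => Finset.mem_univ _)
  simp only [Finset.card_univ, Fintype.card_fin] at this
  rw [multiIdx, Finset.mem_piAntidiag]
  exact ⟨this.symm, fun _ _ => Finset.mem_univ _⟩

lemma prod_word (z : EuclideanSpace ℂ (Fin d)) {n : ℕ} (w : Fin n → Fin d) :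
    ∏ j, z (w j) = monomial z (letterCount w) := by
  rw [monomial, Finset.prod_comp (fun i => z i) w]
  exact Finset.prod_subset (Finset.subset_univ _) fun i _ hi => by
    have : (Finset.univ.filter fun j => w j = i) = ∅ := by
      refine Finset.filter_eq_empty_iff.2 fun j _ hj => hi ?_
      exact Finset.mem_image.2 ⟨j, Finset.mem_univ _, hj⟩
    rw [this]; simp

/-- The number of words with letter count `α` is the multinomial coefficient. -/
lemma card_words {n : ℕ} {α : Fin d → ℕ} (hα : α ∈ multiIdx d n) :
    (Finset.univ.filter fun w : Fin n → Fin d => letterCount w = α).card = multinom α := by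
  -- Both counts are the coefficients of `(∑ z_i)^n`, once expanded over words and once by the
  -- multinomial theorem.
  have key : ∀ z : EuclideanSpace ℂ (Fin d), ∑ α ∈ multiIdx d n,
      (((Finset.univ.filter fun w : Fin n → Fin d => letterCount w = α).card : ℂ) -
        (multinom α : ℂ)) * monomial z α = 0 := by
    intro z
    have h1 : (∑ i, z i) ^ n = ∑ α ∈ multiIdx d n, (multinom α : ℂ) * monomial z α :=
      Finset.sum_pow_eq_sum_piAntidiag _ _ _
    have h2 : (∑ i, z i) ^ n = ∑ w : Fin n → Fin d, monomial z (letterCount w) := by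
      simp only [← prod_word]
      have h3 : (∑ i, z i) ^ n = ∏ _j : Fin n, ∑ i, z i := by simp
      rw [h3, Finset.prod_univ_sum]
      simp
    simp only [sub_mul, Finset.sum_sub_distrib]
    rw [← h1, h2, sub_eq_zero, ← Finset.sum_fiberwise_of_maps_to (fun w _ => letterCount_mem w)]
    refine Finset.sum_congr rfl fun β _ => ?_
    rw [← nsmul_eq_mul]
    symm
    exact Finset.sum_eq_card_nsmul fun w hw => by rw [(Finset.mem_filter.1 hw).2]
  have := sub_eq_zero.1 (poly_unique key hα)
  exact_mod_cast this

lemma sum_words {n : ℕ} {F : Type*} [AddCommMonoid F] (f : (Fin d → ℕ) → F) :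
    ∑ w : Fin n → Fin d, f (letterCount w) = ∑ α ∈ multiIdx d n, multinom α • f α := by
  rw [← Finset.sum_fiberwise_of_maps_to (fun w _ => letterCount_mem w)]
  refine Finset.sum_congr rfl fun β hβ => ?_
  rw [← card_words hβ]
  exact Finset.sum_eq_card_nsmul fun w hw => by rw [(Finset.mem_filter.1 hw).2]

variable (k : UIKernel d) (D : Type u) [NormedAddCommGroup D] [InnerProductSpace ℂ D]

/-- The coordinate functional of `H_k ⊗ D`. -/
def HSpace.coordCLM (α : Fin d → ℕ) : HSpace k D →L[ℂ] D :=
  lp.evalCLM ℂ (fun _ : Fin d → ℕ => D) 2 α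

/-- The coefficients `√(aₙ / multinom α)`. -/
def UIKernel.wordCoeff (α : Fin d → ℕ) : ℝ := Real.sqrt (k.aMulti α) / multinom α

lemma UIKernel.multinom_mul_wordCoeff_sq {n : ℕ} {α : Fin d → ℕ} (hα : α ∈ multiIdx d n) :
    multinom α * k.wordCoeff α ^ 2 = k.coeff n := by
  have hn : ∑ i, α i = n := by simpa [multiIdx] using hα
  have hm : (multinom α : ℝ) ≠ 0 := by exact_mod_cast (Nat.multinomial_pos _ _).ne'
  rw [UIKernel.wordCoeff, div_pow, Real.sq_sqrt (k.aMulti_pos α).le, UIKernel.aMulti, hn]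
  field_simp

/-- The `n`-linear map whose diagonal is the homogeneous part of degree `n` of the evaluation. -/
def evalMultilinear (n : ℕ) :
    MultilinearMap ℂ (fun _ : Fin n => EuclideanSpace ℂ (Fin d)) (HSpace k D →L[ℂ] D) :=
  ∑ w : Fin n → Fin d,
    ((MultilinearMap.mkPiAlgebra ℂ (Fin n) ℂ).compLinearMap fun j =>
      (EuclideanSpace.proj (𝕜 := ℂ) (w j)).toLinearMap).smulRight
        ((k.wordCoeff (letterCount w) : ℂ) • HSpace.coordCLM k D (letterCount w))

variable {k D}

lemma evalMultilinear_apply (n : ℕ) (v : Fin n → EuclideanSpace ℂ (Fin d)) (f : HSpace k D) :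
    evalMultilinear k D n v f = ∑ w : Fin n → Fin d, (∏ j, v j (w j)) •
      (k.wordCoeff (letterCount w) : ℂ) • f.coord (letterCount w) := by
  simp only [evalMultilinear, sum_apply]
  refine Finset.sum_congr rfl fun w _ => ?_
  simp [MultilinearMap.smulRight_apply]
  rfl

lemma evalMultilinear_diag (n : ℕ) (z : EuclideanSpace ℂ (Fin d)) (f : HSpace k D) :
    evalMultilinear k D n (fun _ => z) f =
      ∑ α ∈ multiIdx d n, k.basisFn z α • f.coord α := by
  rw [evalMultilinear_apply]
  simp only [prod_word]
  rw [sum_words (fun α => monomial z α • (k.wordCoeff α : ℂ) • f.coord α)]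
  refine Finset.sum_congr rfl fun α _ => ?_
  have hm : (multinom α : ℂ) ≠ 0 := by exact_mod_cast (Nat.multinomial_pos _ _).ne'
  rw [← Nat.cast_smul_eq_nsmul ℂ, smul_smul, smul_smul]
  congr 1
  simp only [UIKernel.basisFn, UIKernel.wordCoeff]
  push_cast
  field_simp

/-- Cauchy-Schwarz over words: the scalar factors contribute exactly `∏ ‖v j‖`, and the coefficients
contribute at most `√aₙ ‖f‖`. Spreading each coefficient evenly over the words with the same letter
count makes the constant this small. -/
lemma norm_evalMultilinear_le (n : ℕ) (v : Fin n → EuclideanSpace ℂ (Fin d)) :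
    ‖evalMultilinear k D n v‖ ≤ Real.sqrt (k.coeff n) * ∏ j, ‖v j‖ := by
  refine ContinuousLinearMap.opNorm_le_bound _ (by positivity) fun f => ?_
  rw [evalMultilinear_apply]
  have h1 : ∑ w : Fin n → Fin d, ‖∏ j, v j (w j)‖ ^ 2 = (∏ j, ‖v j‖) ^ 2 := by
    rw [← Finset.prod_pow]
    simp only [EuclideanSpace.norm_sq_eq, norm_prod, ← Finset.prod_pow]
    rw [Finset.prod_univ_sum]
    simp
  have h2 : ∑ w : Fin n → Fin d, ‖(k.wordCoeff (letterCount w) : ℂ) • f.coord (letterCount w)‖ ^ 2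
      ≤ k.coeff n * ‖f‖ ^ 2 := by
    rw [sum_words (fun α => ‖(k.wordCoeff α : ℂ) • f.coord α‖ ^ 2)]
    have h3 : ∑ α ∈ multiIdx d n, multinom α • ‖(k.wordCoeff α : ℂ) • f.coord α‖ ^ 2 =
        k.coeff n * ∑ α ∈ multiIdx d n, ‖f.coord α‖ ^ 2 := by
      rw [Finset.mul_sum]
      refine Finset.sum_congr rfl fun α hα => ?_
      rw [norm_smul, mul_pow, Complex.norm_real, Real.norm_eq_abs, sq_abs, nsmul_eq_mul,
        ← mul_assoc, k.multinom_mul_wordCoeff_sq hα]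
    rw [h3, ← f.norm_sq.tsum_eq]
    exact mul_le_mul_of_nonneg_left (f.norm_sq.summable.sum_le_tsum _ fun _ _ => by positivity)
      (k.coeff_pos n).le
  refine (norm_sum_le _ _).trans (abs_le_of_sq_le_sq' ?_ (by positivity)).2
  rw [Finset.sum_congr rfl fun w _ => norm_smul (∏ j, v j (w j)) _]
  refine (Finset.sum_mul_sq_le_sq_mul_sq _ _ _).trans ?_
  rw [h1, mul_pow, mul_pow, Real.sq_sqrt (k.coeff_pos n).le, mul_comm (k.coeff n), mul_assoc]
  exact mul_le_mul_of_nonneg_left h2 (by positivity)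

variable (k D)

/-- The power series at the origin of the evaluation operators of `H_k ⊗ D`. -/
def evalSeries :
    FormalMultilinearSeries ℂ (EuclideanSpace ℂ (Fin d)) (HSpace k D →L[ℂ] D) :=
  fun n => (evalMultilinear k D n).mkContinuous (Real.sqrt (k.coeff n)) (norm_evalMultilinear_le n)

/-- The term of degree `n` has norm at most `√aₙ`, and `aₙ r^(2n)` is bounded for `r < 1` because `∑
aₙ r^(2n)` converges. -/
lemma one_le_radius_evalSeries (hd : 1 ≤ d) : 1 ≤ (evalSeries k D).radius := by
  refine ENNReal.le_of_forall_nnreal_lt fun r hr => ?_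
  have hr1 : (r : ℝ) < 1 := by exact_mod_cast hr
  have hsum : Summable fun n => k.coeff n * ((r : ℝ) ^ 2) ^ n := by
    have := (k.hasSum_gen hd (t := ((r : ℝ) ^ 2 : ℝ)) (by
      rw [Complex.norm_real, Real.norm_of_nonneg (by positivity)]
      nlinarith [r.coe_nonneg])).summable.norm
    refine this.congr fun n => ?_
    rw [← Complex.ofReal_pow, ← Complex.ofReal_mul, Complex.norm_real, mul_comm,
      Real.norm_of_nonneg (mul_nonneg (k.coeff_pos n).le (by positivity))]
  refine (evalSeries k D).le_radius_of_bound
    (Real.sqrt (∑' n, k.coeff n * ((r : ℝ) ^ 2) ^ n)) fun n => ?_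
  refine (mul_le_mul_of_nonneg_right
    (MultilinearMap.mkContinuous_norm_le _ (Real.sqrt_nonneg _) _) (by positivity)).trans ?_
  refine Real.le_sqrt_of_sq_le ?_
  rw [mul_pow, Real.sq_sqrt (k.coeff_pos n).le, ← pow_mul, mul_comm n, pow_mul]
  exact hsum.le_tsum n fun m _ => mul_nonneg (k.coeff_pos m).le (by positivity)

/-- The evaluation operators of `H_k ⊗ D` are the restriction of an operator-valued function that
is analytic on the ball. -/
theorem exists_analytic_eval [CompleteSpace D] (hd : 1 ≤ d) :
    ∃ Θ : EuclideanSpace ℂ (Fin d) → HSpace k D →L[ℂ] D,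
      AnalyticOnNhd ℂ Θ (Ball d) ∧ ∀ (z : Ball d) (f : HSpace k D), Θ z f = f z := by
  have hrad := one_le_radius_evalSeries k D hd
  have hps := (evalSeries k D).hasFPowerSeriesOnBall (zero_lt_one.trans_le hrad)
  have hmem : ∀ z ∈ Ball d, z ∈ Metric.eball (0 : EuclideanSpace ℂ (Fin d)) (evalSeries k D).radius := by
    intro z hz
    refine Metric.eball_subset_eball hrad ?_
    rw [← ENNReal.ofReal_one, Metric.eball_ofReal]
    exact hz
  refine ⟨(evalSeries k D).sum, fun z hz => hps.analyticAt_of_mem (hmem z hz), fun z f => ?_⟩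
  have h1 := hps.hasSum (hmem z z.2)
  rw [zero_add] at h1
  have h2 := h1.mapL (ContinuousLinearMap.apply ℂ D f)
  have h3 := hasSum_multiIdx (f.summable_eval z).hasSum
  refine h2.unique (h3.congr_fun fun n => ?_)
  exact evalMultilinear_diag n z.1 f

end Words

section Main

universe u v

variable {d : ℕ}

/-! ### Powers of commuting tuples -/

lemma prod_ofFn_pow_add {A : Type*} [Monoid A] : ∀ {n : ℕ} (T : Fin n → A)
    (_ : ∀ i j, Commute (T i) (T j)) (α β : Fin n → ℕ),
    (List.ofFn fun i => T i ^ (α + β) i).prod =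
      (List.ofFn fun i => T i ^ α i).prod * (List.ofFn fun i => T i ^ β i).prod
  | 0, _, _, _, _ => by simp
  | n + 1, T, hT, α, β => by
    have ih := prod_ofFn_pow_add (fun i : Fin n => T i.succ) (fun i j => hT _ _)
      (fun i => α i.succ) (fun i => β i.succ)
    have hc : Commute (T 0 ^ β 0) (List.ofFn fun i : Fin n => T i.succ ^ α i.succ).prod := by
      refine Commute.list_prod_right _ _ fun x hx => ?_
      obtain ⟨i, rfl⟩ := (List.mem_ofFn' _ _).1 hx
      exact (hT _ _).pow_pow _ _
    simp only [List.ofFn_succ, List.prod_cons, Pi.add_apply, pow_add] at ih ⊢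
    rw [ih, mul_assoc, mul_assoc, ← mul_assoc (T 0 ^ β 0), hc.eq, mul_assoc]

lemma adjoint_tpow_add {H : Type u} [NormedAddCommGroup H] [InnerProductSpace ℂ H]
    [CompleteSpace H] {T : Fin d → H →L[ℂ] H} (hT : ∀ i j, Commute (T i) (T j))
    (α β : Fin d → ℕ) (h : H) :
    (tpow T (α + β)).adjoint h = (tpow T β).adjoint ((tpow T α).adjoint h) := by
  have : tpow T (α + β) = tpow T α ∘L tpow T β := prod_ofFn_pow_add T hT α β
  rw [this, ContinuousLinearMap.adjoint_comp]
  rfl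

/-! ### Factorization of invariant projections -/

variable {k s : UIKernel d}

/-- Componentwise application of a contraction to a square summable family. -/
lemma exists_lpMap {ι X : Type*} [NormedAddCommGroup X] [InnerProductSpace ℂ X]
    {P : X →L[ℂ] X} (hP : ∀ x, ‖P x‖ ≤ ‖x‖) :
    ∃ A : lp (fun _ : ι => X) 2 →L[ℂ] lp (fun _ : ι => X) 2, (∀ F, ‖A F‖ ≤ ‖F‖) ∧
      ∀ F α, A F α = P (F α) := by
  have hmem : ∀ F : lp (fun _ : ι => X) 2, Memℓp (fun α => P (F α)) 2 := by
    intro F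
    have h := lp.memℓp F
    rw [memℓp_gen_iff (by norm_num)] at h ⊢
    exact h.of_nonneg_of_le (fun α => by positivity)
      fun α => Real.rpow_le_rpow (norm_nonneg _) (hP _) (by norm_num)
  let A : lp (fun _ : ι => X) 2 →ₗ[ℂ] lp (fun _ : ι => X) 2 :=
    { toFun := fun F => ⟨_, hmem F⟩
      map_add' := fun x y => lp.ext (funext fun α => map_add P _ _)
      map_smul' := fun r x => lp.ext (funext fun α => map_smul P _ _) }
  have hA : ∀ F, ‖A F‖ ≤ ‖F‖ := fun F => by
    have h1 := lp.hasSum_norm (p := 2) (by norm_num) (A F)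
    have h2 := lp.hasSum_norm (p := 2) (by norm_num) F
    have h3 := hasSum_le (fun α => Real.rpow_le_rpow (norm_nonneg _) (hP (F α)) (by norm_num))
      h1 h2
    simp only [ENNReal.toReal_ofNat, Real.rpow_ofNat] at h3
    exact (sq_le_sq₀ (norm_nonneg _) (norm_nonneg _)).1 h3
  exact ⟨A.mkContinuous 1 fun F => by simpa using hA F, hA, fun _ _ => rfl⟩

variable {D : Type u} [NormedAddCommGroup D] [InnerProductSpace ℂ D] [CompleteSpace D]

/-- If the kernel of `P* P` is `s` times the kernel of `B* B`, then `P* P = M M*`, where `M` is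
multiplication by the operator-valued function `z ↦ (f ↦ (B* f)(z))` on `H_s ⊗ (H_k ⊗ D)`. -/
theorem exists_mulOp_of_gram (P B : HSpace k D →L[ℂ] HSpace k D) (hP : ∀ f, ‖P f‖ ≤ ‖f‖)
    (hB : ∀ z w x y, s.fn z w * inner ℂ (B (RKHS.kerFun (HSpace k D) z x))
        (B (RKHS.kerFun (HSpace k D) w y)) =
      inner ℂ (P (RKHS.kerFun (HSpace k D) z x)) (P (RKHS.kerFun (HSpace k D) w y))) :
    ∃ M : HSpace s (HSpace k D) →L[ℂ] HSpace k D,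
      (∀ (F : HSpace s (HSpace k D)) (z : Ball d), M F z = B.adjoint (F z) z) ∧
        M ∘L M.adjoint = P.adjoint ∘L P := by
  -- The adjoint of multiplication by `ev_z ∘ B*` must send `k_w ⊗ x` to `s_w ⊗ B (k_w ⊗ x)`. It is
  -- constructed from this formula; the hypothesis on Gram kernels makes it well defined and
  -- contractive.
  obtain ⟨v, hvk⟩ : ∃ v : Ball d → D →ₗ[ℂ] HSpace s (HSpace k D), ∀ w x,
      v w x = RKHS.kerFun (HSpace s (HSpace k D)) w (B (RKHS.kerFun (HSpace k D) w x)) :=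
    ⟨fun w => (RKHS.kerFun (HSpace s (HSpace k D)) w ∘L B ∘L
      RKHS.kerFun (HSpace k D) w).toLinearMap, fun _ _ => rfl⟩
  have hv : ∀ z w x y, inner ℂ (v z x) (v w y) =
      inner ℂ (P (RKHS.kerFun (HSpace k D) z x)) (P (RKHS.kerFun (HSpace k D) w y)) := by
    intro z w x y
    rw [← hB, hvk, hvk]
    exact inner_kerFun_kerFun (F := HSpace k D) z w (B (RKHS.kerFun (HSpace k D) z x))
      (B (RKHS.kerFun (HSpace k D) w y))
  obtain ⟨N, -, hN⟩ := exists_clm_of_kerFun (k := k) v (fun x => by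
    have h1 := inner_lsum v x
    have h2 := inner_lsum (fun w => P.toLinearMap ∘ₗ (RKHS.kerFun (HSpace k D) w).toLinearMap) x
    simp only [hv] at h1
    have h3 := h1.trans h2.symm
    have h4 : Finsupp.lsum ℂ
        (fun w => P.toLinearMap ∘ₗ (RKHS.kerFun (HSpace k D) w).toLinearMap) x =
        P (kerSum k D x) := by
      simp [kerSum, Finsupp.sum, map_sum]
    rw [h4, inner_self_eq_norm_sq_to_K, inner_self_eq_norm_sq_to_K] at h3
    have h5 : ‖Finsupp.lsum ℂ v x‖ ^ 2 = ‖P (kerSum k D x)‖ ^ 2 := by exact_mod_cast h3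
    exact ((sq_eq_sq₀ (norm_nonneg _) (norm_nonneg _)).1 h5).le.trans (hP _))
  refine ⟨N.adjoint, fun F z => ?_, ?_⟩
  · refine ext_inner_left ℂ fun x => ?_
    rw [← RKHS.kerFun_inner, ContinuousLinearMap.adjoint_inner_right, hN, hvk,
      RKHS.kerFun_inner (H := HSpace s (HSpace k D)), ← RKHS.kerFun_inner (H := HSpace k D),
      ContinuousLinearMap.adjoint_inner_right]
  · rw [ContinuousLinearMap.adjoint_adjoint]
    refine clm_ext_kerFun fun w y => RKHS.ext fun z => ext_inner_left ℂ fun x => ?_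
    rw [← RKHS.kerFun_inner, ← RKHS.kerFun_inner, ContinuousLinearMap.comp_apply,
      ContinuousLinearMap.comp_apply, ContinuousLinearMap.adjoint_inner_right,
      ContinuousLinearMap.adjoint_inner_right, hN, hN]
    exact hv z w x y

/-- If the range of the isometry `V` is co-invariant under the multiplication operators `√b_α z^α`,
then `I - V V*` factors through `H_s`. -/
theorem exists_factorization (hd : 1 ≤ d) (hb : ∀ n, 0 ≤ s.b n) {H : Type v}
    [NormedAddCommGroup H] [InnerProductSpace ℂ H] [CompleteSpace H]
    {R : HSpace k D →L[ℂ] lp (fun _ : Fin d → ℕ => HSpace k D) 2} (hR : ∀ f, ‖R f‖ ≤ ‖f‖)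
    (hRk : ∀ w x α, R (RKHS.kerFun (HSpace k D) w x) α =
      s.rowCoeff w.1 α • RKHS.kerFun (HSpace k D) w x)
    (V : H →ₗᵢ[ℂ] HSpace k D) (hV : ∀ h α, ∃ h', R (V h) α = V h') :
    ∃ (B : HSpace k D →L[ℂ] HSpace k D) (M : HSpace s (HSpace k D) →L[ℂ] HSpace k D),
      (∀ (F : HSpace s (HSpace k D)) (z : Ball d), M F z = B (F z) z) ∧
        1 - V.toContinuousLinearMap ∘L V.toContinuousLinearMap.adjoint = M ∘L M.adjoint := by
  set W := V.toContinuousLinearMap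
  have hWW : ∀ h, W.adjoint (W h) = h := fun h => by
    refine ext_inner_left ℂ fun h' => ?_
    rw [ContinuousLinearMap.adjoint_inner_right]
    exact V.inner_map_map _ _
  set P : HSpace k D →L[ℂ] HSpace k D := 1 - W ∘L W.adjoint with hPdef
  have hPa : ∀ f, P f = f - W (W.adjoint f) := fun f => rfl
  have hPW : ∀ h, P (W h) = 0 := fun h => by rw [hPa, hWW, sub_self]
  have hPP : P.adjoint ∘L P = P := by
    have h1 : P.adjoint = P := by
      rw [hPdef, map_sub, ContinuousLinearMap.adjoint_comp, ContinuousLinearMap.adjoint_adjoint]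
      congr 1
      exact ContinuousLinearMap.adjoint_id
    rw [h1]
    ext1 f
    rw [ContinuousLinearMap.comp_apply]
    conv_lhs => rw [hPa f, map_sub, hPW, sub_zero]
  have hPn : ∀ f, ‖P f‖ ≤ ‖f‖ := by
    intro f
    have h1 : ‖P f‖ ^ 2 = RCLike.re (inner ℂ f (P f)) := by
      conv_rhs => rw [← hPP, ContinuousLinearMap.comp_apply,
        ContinuousLinearMap.adjoint_inner_right, inner_self_eq_norm_sq]
    have h2 := re_inner_le_norm (𝕜 := ℂ) f (P f)
    rcases (norm_nonneg (P f)).eq_or_lt with h0 | h0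
    · rw [← h0]; exact norm_nonneg _
    · nlinarith
  obtain ⟨A, hA, hAP⟩ := exists_lpMap (ι := Fin d → ℕ) hPn
  -- Co-invariance gives `A R W = 0`, hence `A R = A R P`, and both `A` and `R` are contractions.
  have hle : ∀ f, ‖(A ∘L R) f‖ ≤ ‖P f‖ := by
    intro f
    have h1 : f = P f + W (W.adjoint f) := by rw [hPa]; abel
    have h2 : A (R (W (W.adjoint f))) = 0 := by
      refine lp.ext (funext fun α => ?_)
      obtain ⟨h', hh'⟩ := hV (W.adjoint f) α
      rw [hAP]
      exact (congrArg P hh').trans (hPW h')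
    have h3 : (A ∘L R) f = A (R (P f)) := by
      conv_lhs => rw [h1]
      rw [ContinuousLinearMap.comp_apply, map_add, map_add, h2, add_zero]
    rw [h3]
    exact (hA _).trans (hR _)
  obtain ⟨B, hB⟩ := exists_sqrt_sub (A ∘L R) P hle
  -- On kernel functions the form of `A R` is `1 - 1/s` times that of `P`, so the form of `B` is
  -- `1/s` times it.
  obtain ⟨M, hM, hMM⟩ := exists_mulOp_of_gram (s := s) P B hPn (fun z w x y => by
    have h1 := lp.hasSum_inner (𝕜 := ℂ) (A (R (RKHS.kerFun (HSpace k D) z x)))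
      (A (R (RKHS.kerFun (HSpace k D) w y)))
    simp only [hAP, hRk, map_smul, inner_smul_left, inner_smul_right] at h1
    have h2 := (UIKernel.hasSum_rowCoeff hd hb z w).mul_right
      (inner ℂ (P (RKHS.kerFun (HSpace k D) z x)) (P (RKHS.kerFun (HSpace k D) w y)))
    rw [hB, ContinuousLinearMap.comp_apply, ContinuousLinearMap.comp_apply,
      h1.unique (h2.congr_fun fun α => by ring)]
    have := s.fn_ne_zero z w
    field_simp
    ring)
  exact ⟨B.adjoint, M, hM, by rw [hMM, hPP]⟩

end Main

end CharFn

end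

theorem mainTheorem2 {d : ℕ} (hd : 1 ≤ d) (k s : CharFn.UIKernel d)
    (g : CharFn.Ball d → CharFn.Ball d → ℂ)
    (hs : s.IsCNP) (hg : CharFn.IsPositiveKernel g)
    (hk : ∀ z w : CharFn.Ball d, k.fn z w = s.fn z w * g z w)
    {H : Type*} [NormedAddCommGroup H] [InnerProductSpace ℂ H] [CompleteSpace H]
    (T : Fin d → H →L[ℂ] H) (hT : CharFn.IsInvContraction k T) (hp : hT.IsPure) :
    hp.AdmitsCharFn s := by
  -- Only row-valued interpolation, `m = 1`, is needed.
  have hb : ∀ n, 0 ≤ s.b n :=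
    CharFn.UIKernel.HasNP.b_nonneg hd fun n hn => hs.2 1 n one_pos hn
  obtain ⟨R, hR, hRk⟩ := CharFn.exists_rowOp (D := hT.defectSpace) hd hb hg hk
  -- The component `α` of `R (V h)` is `V` applied to `√b_α (T^α)* h`: the weights `√a_{α+β}`
  -- cancel, and commutativity splits `(T^(α+β))*`.
  obtain ⟨B, M, hM, hMM⟩ := CharFn.exists_factorization hd hb hR hRk hp.V (fun h α => by
    refine ⟨(Real.sqrt (s.bMulti α) : ℂ) • (CharFn.tpow T α).adjoint h,
      CharFn.HSpace.ext_coord fun β => ?_⟩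
    rw [CharFn.coord_rowOp hRk]
    change _ • (Real.sqrt (k.aMulti (α + β)) : ℂ) • hT.defectAdj (α + β) h =
      (Real.sqrt (k.aMulti β) : ℂ) • hT.defectAdj β
        ((Real.sqrt (s.bMulti α) : ℂ) • (CharFn.tpow T α).adjoint h)
    have h1 : hT.defectAdj (α + β) h = hT.defectAdj β ((CharFn.tpow T α).adjoint h) :=
      Subtype.ext (congrArg hT.defect (CharFn.adjoint_tpow_add hT.1 α β h))
    have hne : (Real.sqrt (k.aMulti (α + β)) : ℂ) ≠ 0 := by
      exact_mod_cast (Real.sqrt_pos.2 (k.aMulti_pos _)).ne'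
    rw [h1, map_smul, smul_smul, smul_smul]
    congr 1
    field_simp)
  obtain ⟨Θ, hΘ, hΘe⟩ := CharFn.exists_analytic_eval k hT.defectSpace hd
  refine ⟨CharFn.HSpace k hT.defectSpace, inferInstance, inferInstance, inferInstance,
    fun z => Θ z ∘L B, M, ?_, fun F z => ?_, hMM⟩
  · exact ((ContinuousLinearMap.compL ℂ _ _ _).flip B).comp_analyticOnNhd hΘ
  · rw [hM, ContinuousLinearMap.comp_apply, hΘe]
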